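/- Let $\mathcal G$ be a snake graph with tiles $G_1,\dots,G_n$ ($n\ge 1$; each tile is a unit square glued to the East or North edge of the previous one), and let $d\ge 0$ be an integer. A $d$-dimer cover of $\mathcal G$ is a multiset of edges such that every vertex is incident to exactly $d$ of its members, counted with multiplicity. The abstract string $w_{\mathcal G}$ of $\mathcal G$ has one vertex for each tile and one arrow between consecutive vertices; the first arrow is direct ($\to$) if $G_2$ lies to the right of $G_1$ and inverse ($\leftarrow$) otherwise, and the $i$-th arrow is equal to the $(i-1)$-st one if $G_{i-1},G_i,G_{i+1}$ form a zig-zag and opposite to it if they form a straight piece. Let $K$ be a field, $Q$ a quiver with finitely many vertices, $I$ a two-sided ideal of $KQ$ (for example an admissible one), $\Lambda=KQ/I$, and let $M_{\mathcal G}\in\operatorname{mod}\Lambda$ be a string module whose string in $Q$ has underlying abstract string $w_{\mathcal G}$, with standard basis $v_1,\dots,v_n$. Let $\widetilde M_{\mathcal G}=M_{\mathcal G}\otimes_K K[\varepsilon]/(\varepsilon^d)$ be the induced module over $\Lambda\otimes_K K[\varepsilon]/(\varepsilon^d)$. A submodule of $\widetilde M_{\mathcal G}$ is called canonical if it is spanned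 over $K$ by some of the vectors $v_i\otimes\varepsilon^k$. Then: 1. The number of $d$-dimer covers of $\mathcal G$ is finite and equal to the number of canonical submodules of $\widetilde M_{\mathcal G}$. If the string does not pass through a vertex of $Q$ twice, then every submodule of $\widetilde M_{\mathcal G}$ is canonical, so that the number of $d$-dimer covers is the number of all submodules of $\widetilde M_{\mathcal G}$. Let moreover $a_1,\dots,a_m$ be positive integers such that $\mathcal G=\mathcal G[a_1,\dots,a_m]$ is the snake graph of the continued fraction $[a_1,\dots,a_m]$. That is, for a function on the edges with values in $\{+,-\}$ which on every tile is equal on North and West, equal on South and East, and different on North and South, the signs of a West or South edge of $G_1$, of the $n-1$ interior edges in order, and of a North or East edge of $G_n$ form a sequence of $a_1$ equal signs, then $a_2$ opposite signs, then $a_3$ signs equal to the first ones, and so on. Write $\left(\!\binom{a}{k}\!\right)=\binom{a+k-1}{k}$. 2. The number of canonical submodules of $\widetilde M_{\mathcal G}$ is the top left entry of the matrix product $\Lambda_d(a_1)\Lambda_d(a_2)\cdots\Lambda_d(a_m)$, where $\Lambda_d(a)$ is the $(d+1)\times(d+1)$ matrix, with rows and columns indexed by $0,\dots,d$, whose $(i,j)$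 entry is $\left(\!\binom{a}{d-i-j}\!\right)$ if $i+j\le d$ and $0$ otherwise. 3. Define the higher continued fraction $(r_i[a_1,\dots,a_m])_{0\le i\le d}$ of order $d$ recursively by $r_i[a_m]=\left(\!\binom{a_m}{i}\!\right)$ and $$r_i[a_1,\dots,a_m]=\left(\!\binom{a_1}{i}\!\right)+\sum_{j=1}^{i}\left(\!\binom{a_1}{i-j}\!\right)\frac{r_{d-j}[a_2,\dots,a_m]}{r_d[a_2,\dots,a_m]}\qquad (m\ge 2).$$ Clearing denominators step by step and without cancellation writes it with a common positive denominator, $r_i[a_1,\dots,a_m]=p_i[a_1,\dots,a_m]/q[a_1,\dots,a_m]$, where $p_i[a_m]=\left(\!\binom{a_m}{i}\!\right)$, $q[a_m]=1$ and, for $m\ge2$, $q[a_1,\dots,a_m]=p_d[a_2,\dots,a_m]$ and $$p_i[a_1,\dots,a_m]=\left(\!\binom{a_1}{i}\!\right)p_d[a_2,\dots,a_m]+\sum_{j=1}^{i}\left(\!\binom{a_1}{i-j}\!\right)p_{d-j}[a_2,\dots,a_m].$$ The number of canonical submodules of $\widetilde M_{\mathcal G}$ is the numerator $p_d[a_1,\dots,a_m]$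 of $r_d[a_1,\dots,a_m]$, and, whenever $m\ge2$ and $a_2+\dots+a_m\ge 2$, the denominator $q[a_1,\dots,a_m]$ is the number of $d$-dimer covers of $\mathcal G[a_2,\dots,a_m]$. -/

import Mathlib

open scoped TensorProduct

/-! ### Snake graphs -/

/-- The two possible positions of a tile relative to the previous one. -/
inductive SnakeStep : Type
  | right
  | up
  deriving DecidableEq

/-- The lower left corner of the tile `i` (counted from `0`) of the snake graph with
`s.length + 1` tiles in which consecutive tiles are placed as prescribed by `s`. -/
def tileCorner (s : List SnakeStep) (i : ℕ) : ℕ × ℕ :=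
  ((s.take i).count SnakeStep.right, (s.take i).count SnakeStep.up)

/-- South side of the tile `i`. -/
def southSide (s : List SnakeStep) (i : ℕ) : Sym2 (ℕ × ℕ) :=
  s(tileCorner s i, tileCorner s i + (1, 0))

/-- West side of the tile `i`. -/
def westSide (s : List SnakeStep) (i : ℕ) : Sym2 (ℕ × ℕ) :=
  s(tileCorner s i, tileCorner s i + (0, 1))

/-- North side of the tile `i`. -/
def northSide (s : List SnakeStep) (i : ℕ) : Sym2 (ℕ × ℕ) :=
  s(tileCorner s i + (0, 1), tileCorner s i + (1, 1))

/-- East side of the tile `i`. -/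
def eastSide (s : List SnakeStep) (i : ℕ) : Sym2 (ℕ × ℕ) :=
  s(tileCorner s i + (1, 0), tileCorner s i + (1, 1))

/-- The snake graph with tiles `0, …, s.length`; its vertices are the points of `support`. -/
def snakeGraph (s : List SnakeStep) : SimpleGraph (ℕ × ℕ) :=
  SimpleGraph.fromEdgeSet
    {e | ∃ i ≤ s.length,
      e = southSide s i ∨ e = westSide s i ∨ e = northSide s i ∨ e = eastSide s i}

/-- The `d`-dimer covers of a graph: multisets of edges such that every vertex is incident to
exactly `d` members, counted with multiplicity. -/
def dimerCovers {W : Type*} [DecidableEq W] (G : SimpleGraph W) (d : ℕ) :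
    Set (Multiset (Sym2 W)) :=
  {D | (∀ e ∈ D, e ∈ G.edgeSet) ∧ ∀ v ∈ G.support, D.countP (fun e => v ∈ e) = d}

/-! ### The snake graph of a continued fraction -/

/-- A sign function on (the edges of) a snake graph: on every tile the North and West sides have
the same sign, the South and East sides have the same sign, and North and South differ. -/
def IsSignFunction (s : List SnakeStep) (f : Sym2 (ℕ × ℕ) → Bool) : Prop :=
  ∀ i ≤ s.length, f (northSide s i) = f (westSide s i) ∧ f (southSide s i) = f (eastSide s i) ∧
    f (northSide s i) ≠ f (southSide s i)

/-- The edge shared by the tiles `i` and `i + 1`. -/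
def interiorEdge (s : List SnakeStep) (i : Fin s.length) : Sym2 (ℕ × ℕ) :=
  match s.get i with
  | SnakeStep.right => eastSide s i
  | SnakeStep.up => northSide s i

/-- `a₁` signs `b`, followed by `a₂` signs `!b`, followed by `a₃` signs `b`, and so on. -/
def signSequence : List ℕ → Bool → List Bool
  | [], _ => []
  | k :: a, b => List.replicate k b ++ signSequence a (!b)

/-- The snake graph is the snake graph `𝒢[a₁, …, aₙ]` of the continued fraction
`[a₁, …, aₙ]` with positive integers `aᵢ`: the signs of a side `e` (West or South) of the first
tile, of the interior edges in order, and of a side `e'` (North or East) of the last tile form the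
sign sequence of `a₁, …, aₙ`. -/
def IsSnakeGraphOfCF (s : List SnakeStep) (a : List ℕ) : Prop :=
  (∀ k ∈ a, 0 < k) ∧
    ∃ f, IsSignFunction s f ∧
      ∃ e e', (e = westSide s 0 ∨ e = southSide s 0) ∧
        (e' = northSide s s.length ∨ e' = eastSide s s.length) ∧
        ∃ b, signSequence a b =
          f e :: (List.ofFn (fun i => f (interiorEdge s i)) ++ [f e'])

/-! ### Matrices and higher continued fractions -/

/-- The `(d + 1) × (d + 1)` matrix whose `(i, j)` entry (`0 ≤ i, j ≤ d`) is the number of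
multisets of size `d - i - j` in a set of `a` elements, and `0` if `i + j > d`. -/
def multichooseMatrix (d a : ℕ) : Matrix (Fin (d + 1)) (Fin (d + 1)) ℕ :=
  Matrix.of fun i j =>
    if (i : ℕ) + (j : ℕ) ≤ d then Nat.multichoose a (d - (i : ℕ) - (j : ℕ)) else 0

/-- The `i`-th entry, `0 ≤ i ≤ d`, of the higher continued fraction `[a₁, …, aₙ]` of order `d`
(the usual continued fraction is the entry `1` for `d = 1`). -/
def higherCF (d : ℕ) : List ℕ → ℕ → ℚ
  | [], _ => 1
  | [a], i => Nat.multichoose a i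
  | a :: b :: l, i => Nat.multichoose a i +
      ∑ j ∈ Finset.Icc 1 i,
        (Nat.multichoose a (i - j) : ℚ) * (higherCF d (b :: l) (d - j) / higherCF d (b :: l) d)

/-- The numerator of the entry `i` of the higher continued fraction, obtained by clearing
denominators step by step without any cancellation. -/
def higherCFNum (d : ℕ) : List ℕ → ℕ → ℕ
  | [], _ => 1
  | [a], i => Nat.multichoose a i
  | a :: b :: l, i => Nat.multichoose a i * higherCFNum d (b :: l) d +
      ∑ j ∈ Finset.Icc 1 i, Nat.multichoose a (i - j) * higherCFNum d (b :: l) (d - j)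

/-- The common denominator of the entries of the higher continued fraction, obtained by clearing
denominators step by step without any cancellation. -/
def higherCFDen (d : ℕ) : List ℕ → ℕ
  | [] => 1
  | [_] => 1
  | _ :: b :: l => higherCFNum d (b :: l) d

/-! ### The abstract string of a snake graph -/

/-- The arrows of the abstract string following an arrow `b` that belongs to the step `p`
(`true` is a direct arrow, `false` an inverse one): the arrow is repeated at a zig-zag and
reversed at a straight piece. -/
def abstractStringAux : SnakeStep → Bool → List SnakeStep → List Bool
  | _, _, [] => []
  | p, b, q :: l =>
    let c := if q = p then !b else b
    c :: abstractStringAux q c l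

/-- The arrows of the abstract string of a snake graph; it has one vertex per tile. -/
def abstractString : List SnakeStep → List Bool
  | [] => []
  | p :: l => decide (p = SnakeStep.right) :: abstractStringAux p (decide (p = SnakeStep.right)) l

/-! ### Path algebras -/

section PathAlgebra

variable (K : Type*) [Field K] (V : Type*) [Fintype V] [Quiver V]

/-- Defining relations of the path algebra on the generators `e_v` (`v` a vertex) and `α` (an
arrow). Products are ordered so that left modules are representations of the quiver: an arrow
`α : x ⟶ y` satisfies `e_y α e_x = α`. -/
inductive PathRel : FreeAlgebra K (V ⊕ Quiver.Total V) → FreeAlgebra K (V ⊕ Quiver.Total V) → Prop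
  | idem (v : V) : PathRel
      (FreeAlgebra.ι K (Sum.inl v) * FreeAlgebra.ι K (Sum.inl v)) (FreeAlgebra.ι K (Sum.inl v))
  | orth (v v' : V) (h : v ≠ v') : PathRel
      (FreeAlgebra.ι K (Sum.inl v) * FreeAlgebra.ι K (Sum.inl v')) 0
  | one : PathRel (∑ v : V, FreeAlgebra.ι K (Sum.inl v)) 1
  | target (a : Quiver.Total V) : PathRel
      (FreeAlgebra.ι K (Sum.inl a.right) * FreeAlgebra.ι K (Sum.inr a))
      (FreeAlgebra.ι K (Sum.inr a))
  | source (a : Quiver.Total V) : PathRel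
      (FreeAlgebra.ι K (Sum.inr a) * FreeAlgebra.ι K (Sum.inl a.left))
      (FreeAlgebra.ι K (Sum.inr a))

/-- The path algebra `KQ` of a quiver `Q` with finitely many vertices. -/
abbrev PathAlgebra : Type _ := RingQuot (PathRel K V)

end PathAlgebra

/-! ### Strings and string modules -/

/-- The position of the source of the `i`-th arrow of an abstract string. -/
def tailIndex (u : List Bool) (i : Fin u.length) : Fin (u.length + 1) :=
  if u.get i then i.castSucc else i.succ

/-- The position of the target of the `i`-th arrow of an abstract string. -/
def headIndex (u : List Bool) (i : Fin u.length) : Fin (u.length + 1) :=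
  if u.get i then i.succ else i.castSucc

/-- A string in a quiver with underlying abstract string `u`: a walk whose `i`-th letter is an
arrow (if `u` has a direct arrow there) or the formal inverse of an arrow (otherwise), without
subwords `α α⁻¹` or `α⁻¹ α`. -/
structure QuiverString (V : Type*) [Quiver V] (u : List Bool) where
  /-- the vertices of the walk -/
  vertex : Fin (u.length + 1) → V
  /-- the arrows of the walk -/
  letter : Fin u.length → Quiver.Total V
  left_letter : ∀ i, (letter i).left = vertex (tailIndex u i)
  right_letter : ∀ i, (letter i).right = vertex (headIndex u i)
  reduced : ∀ i j : Fin u.length, (j : ℕ) = (i : ℕ) + 1 → u.get i ≠ u.get j → letter i ≠ letter j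

namespace QuiverString

variable (K : Type*) [Field K] {V : Type*} [Quiver V] {u : List Bool} (w : QuiverString V u)

open Classical in
/-- The idempotent `e_v` projects onto the span of the basis vectors at vertex `v`. -/
noncomputable def vertexMap (v : V) : Module.End K (Fin (u.length + 1) → K) :=
  LinearMap.pi fun i => if w.vertex i = v then LinearMap.proj i else 0

open Classical in
/-- The arrow `a` sends the basis vector at the source of each letter equal to `a` to the basis
vector at the target of that letter, and kills the other basis vectors. -/
noncomputable def arrowMap (a : Quiver.Total V) : Module.End K (Fin (u.length + 1) → K) :=
  ∑ i : Fin u.length, if w.letter i = a then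
    (LinearMap.single K (fun _ => K) (headIndex u i)) ∘ₗ LinearMap.proj (tailIndex u i) else 0

theorem vertexMap_apply (v : V) (x : Fin (u.length + 1) → K) (i : Fin (u.length + 1)) :
    w.vertexMap K v x i = open Classical in if w.vertex i = v then x i else 0 := by
  classical
  simp only [vertexMap, LinearMap.pi_apply]
  split_ifs <;> simp

theorem arrowMap_apply (a : Quiver.Total V) (x : Fin (u.length + 1) → K)
    (j : Fin (u.length + 1)) :
    w.arrowMap K a x j = open Classical in
      ∑ i : Fin u.length, if w.letter i = a ∧ headIndex u i = j then x (tailIndex u i) else 0 := by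
  classical
  simp only [arrowMap, LinearMap.sum_apply, Finset.sum_apply]
  refine Finset.sum_congr rfl fun i _ => ?_
  by_cases h : w.letter i = a
  · by_cases h' : headIndex u i = j
    · subst h'; simp [h]
    · simp [h, h', Ne.symm h']
  · simp [h]

variable [Fintype V]

/-- The action of the path algebra on the string representation `M(w)`. -/
noncomputable def pathAction : PathAlgebra K V →ₐ[K] Module.End K (Fin (u.length + 1) → K) :=
  RingQuot.liftAlgHom K ⟨FreeAlgebra.lift K (Sum.elim (w.vertexMap K) (w.arrowMap K)), by
    classical
    intro x y h
    cases h with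
    | idem v =>
      refine LinearMap.ext fun x => funext fun i => ?_
      by_cases h1 : w.vertex i = v
      · simp [vertexMap_apply, h1]
      · simp [vertexMap_apply, h1]
    | orth v v' h =>
      refine LinearMap.ext fun x => funext fun i => ?_
      by_cases h1 : w.vertex i = v
      · simp [vertexMap_apply, h1, h]
      · simp [vertexMap_apply, h1]
    | one =>
      refine LinearMap.ext fun x => funext fun i => ?_
      simp [vertexMap_apply, LinearMap.sum_apply, Finset.sum_apply]
    | target a =>
      refine LinearMap.ext fun x => funext fun j => ?_
      simp only [map_mul, FreeAlgebra.lift_ι_apply, Sum.elim_inl, Sum.elim_inr,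
        Module.End.mul_apply, vertexMap_apply, arrowMap_apply]
      split_ifs with hj
      · rfl
      · symm
        refine Finset.sum_eq_zero fun i _ => if_neg ?_
        rintro ⟨rfl, rfl⟩
        exact hj (w.right_letter i).symm
    | source a =>
      refine LinearMap.ext fun x => funext fun j => ?_
      simp only [map_mul, FreeAlgebra.lift_ι_apply, Sum.elim_inl, Sum.elim_inr,
        Module.End.mul_apply, vertexMap_apply, arrowMap_apply]
      refine Finset.sum_congr rfl fun i _ => ?_
      by_cases h : w.letter i = a ∧ headIndex u i = j
      · rw [if_pos h, if_pos h, if_pos]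
        rw [← h.1]; exact (w.left_letter i).symm
      · rw [if_neg h, if_neg h]⟩

/-- The ideal `I` annihilates the string representation, i.e. `M(w)` is a module over `KQ/I`.
(In particular no directed path occurring in `w` or in its inverse lies in `I`; if `I` is generated
by paths, the two conditions are equivalent.) -/
def IsAnnihilatedBy (I : Ideal (PathAlgebra K V)) : Prop :=
  ∀ x ∈ I, w.pathAction K x = 0

end QuiverString

section Modules

variable {K : Type*} [Field K] {V : Type*} [Quiver V] [Fintype V] {u : List Bool}

/-- The string module `M(w)` over `Λ = KQ/I`, with one basis vector per vertex of `w`. -/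
def StringModule (w : QuiverString V u) (I : Ideal (PathAlgebra K V))
    (_ : w.IsAnnihilatedBy K I) : Type _ :=
  Fin (u.length + 1) → K

namespace StringModule

variable (w : QuiverString V u) (I : Ideal (PathAlgebra K V)) (hI : w.IsAnnihilatedBy K I)

instance : AddCommGroup (StringModule w I hI) :=
  inferInstanceAs (AddCommGroup (Fin (u.length + 1) → K))

instance : Module K (StringModule w I hI) :=
  inferInstanceAs (Module K (Fin (u.length + 1) → K))

/-- The basis vector of the string module at the `i`-th vertex of the string. -/
def basisVec (i : Fin (u.length + 1)) : StringModule w I hI :=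
  (Pi.single i 1 : Fin (u.length + 1) → K)

variable [I.IsTwoSided]

/-- The action of `Λ = KQ/I` on the string module. -/
noncomputable def action : (PathAlgebra K V ⧸ I) →ₐ[K] Module.End K (StringModule w I hI) :=
  Ideal.Quotient.liftₐ I (w.pathAction K) hI

noncomputable instance : Module (PathAlgebra K V ⧸ I) (StringModule w I hI) :=
  Module.compHom _ (action w I hI).toRingHom

theorem smul_def (x : PathAlgebra K V ⧸ I) (m : StringModule w I hI) :
    x • m = action w I hI x m := rfl

instance : IsScalarTower K (PathAlgebra K V ⧸ I) (StringModule w I hI) where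
  smul_assoc c x m := by
    simp only [smul_def, map_smul, LinearMap.smul_apply]

end StringModule

end Modules

/-! ### Induced modules -/

/-- The truncated polynomial algebra `K[ε]/(ε^d)`. -/
abbrev TruncPoly (K : Type*) [Field K] (d : ℕ) : Type _ :=
  Polynomial K ⧸ Ideal.span {(Polynomial.X : Polynomial K) ^ d}

/-- The class of `ε` in `K[ε]/(ε^d)`. -/
noncomputable def TruncPoly.eps (K : Type*) [Field K] (d : ℕ) : TruncPoly K d :=
  Ideal.Quotient.mk _ Polynomial.X

/-- The induced module `M ⊗_K K[ε]/(ε^d)` of a `Λ`-module `M`, a module over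
`Λ ⊗_K K[ε]/(ε^d)`. -/
def InducedModule (K : Type*) [Field K] (Λ : Type*) [Ring Λ] [Algebra K Λ] (M : Type*)
    [AddCommGroup M] [Module K M] [Module Λ M] [IsScalarTower K Λ M] (d : ℕ) : Type _ :=
  M ⊗[K] TruncPoly K d

namespace InducedModule

variable (K : Type*) [Field K] (Λ : Type*) [Ring Λ] [Algebra K Λ] (M : Type*)
    [AddCommGroup M] [Module K M] [Module Λ M] [IsScalarTower K Λ M] (d : ℕ)

noncomputable instance : AddCommGroup (InducedModule K Λ M d) :=
  inferInstanceAs (AddCommGroup (M ⊗[K] TruncPoly K d))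

noncomputable instance : Module K (InducedModule K Λ M d) :=
  inferInstanceAs (Module K (M ⊗[K] TruncPoly K d))

/-- The pure tensor `m ⊗ p` as an element of the induced module. -/
noncomputable def tmul (m : M) (p : TruncPoly K d) : InducedModule K Λ M d :=
  (m ⊗ₜ[K] p : M ⊗[K] TruncPoly K d)

/-- The action `(x ⊗ q) • (m ⊗ p) = x m ⊗ q p`. -/
noncomputable def action : (Λ ⊗[K] TruncPoly K d) →ₐ[K] Module.End K (InducedModule K Λ M d) :=
  (Module.endTensorEndAlgHom (R := K) (S := K) (A := K) (M := M) (N := TruncPoly K d)).comp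
    (Algebra.TensorProduct.map (Algebra.lsmul K K M) (Algebra.lmul K (TruncPoly K d)))

noncomputable instance : Module (Λ ⊗[K] TruncPoly K d) (InducedModule K Λ M d) :=
  Module.compHom _ (action K Λ M d).toRingHom

theorem smul_tmul (x : Λ) (q p : TruncPoly K d) (m : M) :
    (x ⊗ₜ[K] q : Λ ⊗[K] TruncPoly K d) • tmul K Λ M d m p = tmul K Λ M d (x • m) (q * p) := rfl

end InducedModule

section InducedString

variable {K : Type*} [Field K] {V : Type*} [Quiver V] [Fintype V] {u : List Bool}

/-- The induced module `M(w) ⊗_K K[ε]/(ε^d)` of a string module. -/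
abbrev InducedStringModule (w : QuiverString V u) (I : Ideal (PathAlgebra K V)) [I.IsTwoSided]
    (hI : w.IsAnnihilatedBy K I) (d : ℕ) : Type _ :=
  InducedModule K (PathAlgebra K V ⧸ I) (StringModule w I hI) d

/-- The submodules, over `Λ ⊗_K K[ε]/(ε^d)`, of the induced module of a string module. -/
abbrev InducedStringSubmodule (w : QuiverString V u) (I : Ideal (PathAlgebra K V)) [I.IsTwoSided]
    (hI : w.IsAnnihilatedBy K I) (d : ℕ) : Type _ :=
  Submodule ((PathAlgebra K V ⧸ I) ⊗[K] TruncPoly K d) (InducedStringModule w I hI d)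

/-- The canonical submodules of the induced module of a string module: the submodules that are
spanned over `K` by some of the standard basis vectors `v_i ⊗ ε^k`. -/
def canonicalSubmodules (w : QuiverString V u) (I : Ideal (PathAlgebra K V)) [I.IsTwoSided]
    (hI : w.IsAnnihilatedBy K I) (d : ℕ) : Set (InducedStringSubmodule w I hI d) :=
  {N | ∃ S : Set (Fin (u.length + 1) × ℕ),
    (N : Set (InducedStringModule w I hI d)) = Submodule.span K
      ((fun p => InducedModule.tmul K (PathAlgebra K V ⧸ I) (StringModule w I hI) d
        (StringModule.basisVec w I hI p.1) (TruncPoly.eps K d ^ p.2)) '' S)}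

end InducedString

/-!
A `d`-dimer cover is determined by how often it uses one chosen side of each tile, and a canonical
submodule of the induced module by the ideal of `K[ε]/(ε^d)` it has at each standard basis vector.
The ideals form a chain of `d + 1` elements, so either way the object is a labeling of the vertices
of the abstract string by `0, …, d`; the local constraints are, in both cases, that labels increase
weakly along the arrows.

Such labelings are counted by a product of transfer matrices, one factor `Z i j = [i ≤ j]` or `Zᵀ`
per arrow. With the reversal permutation matrix `J` one has `Λ_d(a) = Z ^ a * J` and
`J * Z * J = Zᵀ`. Hence `Λ_d(a₁) ⋯ Λ_d(a_m)` is, up to a final power of `J`, the word in `Z` and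
`Zᵀ` read off from the signs of the snake graph, and its first and last factor turn the corner entry
into the sum of all entries of the word given by the interior signs. The first columns of the
partial products satisfy the recursion of the numerators of the higher continued fraction.
-/

/-! ### Transfer matrices -/

section Labelings

variable {α : Type*}

/-- The transfer matrix of a direct arrow, i.e. the zeta matrix of a preorder. -/
def zetaMatrix (α : Type*) [LE α] [DecidableLE α] : Matrix α α ℕ :=
  Matrix.of fun i j => if i ≤ j then 1 else 0

/-- The transfer matrix of a direct (`true`) or inverse (`false`) arrow. -/
def arrowMatrix (α : Type*) [LE α] [DecidableLE α] (b : Bool) : Matrix α α ℕ :=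
  if b then zetaMatrix α else (zetaMatrix α).transpose

/-- The transfer matrix of an abstract string. -/
def stringMatrix (α : Type*) [LE α] [DecidableLE α] [Fintype α] [DecidableEq α] (u : List Bool) :
    Matrix α α ℕ :=
  (u.map (arrowMatrix α)).prod

/-- The labelings of the vertices of an abstract string that increase weakly along each arrow. -/
def monotoneLabelings (α : Type*) [LE α] (u : List Bool) : Set (Fin (u.length + 1) → α) :=
  {h | ∀ i, h (tailIndex u i) ≤ h (headIndex u i)}

theorem sum_prod_cons_eq_sum_list_prod_apply {R : Type*} [CommSemiring R] [Fintype α]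
    [DecidableEq α] :
    ∀ {n : ℕ} (M : Fin n → Matrix α α R) (i : α),
      ∑ t : Fin n → α, ∏ k, M k ((Fin.cons i t : Fin (n + 1) → α) k.castSucc) (t k) =
        ∑ j, (List.ofFn M).prod i j
  | 0, _, i => by simp [Matrix.one_apply]
  | n + 1, M, i => by
    have ih (j : α) := sum_prod_cons_eq_sum_list_prod_apply (fun k => M k.succ) j
    simp only [← (Fin.consEquiv fun _ => α).sum_comp, Fintype.sum_prod_type, Fin.consEquiv_apply,
      Fin.prod_univ_succ, Fin.castSucc_zero, Fin.cons_zero, Fin.cons_succ, ← Fin.succ_castSucc,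
      ← Finset.mul_sum, ih, List.ofFn_succ, List.prod_cons, Matrix.mul_apply]
    simp only [Finset.mul_sum]
    exact Finset.sum_comm

theorem sum_prod_eq_sum_list_prod_apply {R : Type*} [CommSemiring R] [Fintype α] [DecidableEq α]
    {n : ℕ} (M : Fin n → Matrix α α R) :
    ∑ t : Fin (n + 1) → α, ∏ k : Fin n, M k (t k.castSucc) (t k.succ) =
      ∑ i, ∑ j, (List.ofFn M).prod i j := by
  simp only [← (Fin.consEquiv fun _ => α).sum_comp, Fintype.sum_prod_type, Fin.consEquiv_apply,
    Fin.cons_succ, sum_prod_cons_eq_sum_list_prod_apply]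

theorem arrowMatrix_get_apply [LE α] [DecidableLE α] (u : List Bool) (i : Fin u.length)
    (h : Fin (u.length + 1) → α) :
    arrowMatrix α (u.get i) (h i.castSucc) (h i.succ) =
      if h (tailIndex u i) ≤ h (headIndex u i) then 1 else 0 := by
  cases hi : u.get i <;>
    simp only [arrowMatrix, tailIndex, headIndex, hi, if_true, Bool.false_eq_true, if_false,
      Matrix.transpose_apply, zetaMatrix, Matrix.of_apply]

theorem ncard_monotoneLabelings [LE α] [DecidableLE α] [Fintype α] [DecidableEq α]
    (u : List Bool) :
    (monotoneLabelings α u).ncard = ∑ i, ∑ j, stringMatrix α u i j := by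
  have hu : u.map (arrowMatrix α) = List.ofFn fun i => arrowMatrix α (u.get i) := by
    conv_lhs => rw [← List.ofFn_get u, List.map_ofFn]
    rfl
  rw [stringMatrix, hu, ← sum_prod_eq_sum_list_prod_apply]
  simp only [arrowMatrix_get_apply, Finset.prod_boole, Finset.mem_univ, true_implies,
    Finset.sum_boole, Nat.cast_id, ← Set.ncard_coe_finset, Finset.coe_filter, true_and]
  rfl

end Labelings

section MultichooseMatrix

variable (d : ℕ)

/-- The permutation matrix of the order reversal of `{0, …, d}`. -/
def reversalMatrix : Matrix (Fin (d + 1)) (Fin (d + 1)) ℕ :=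
  Fin.revPerm.permMatrix ℕ

theorem reversalMatrix_mul (M : Matrix (Fin (d + 1)) (Fin (d + 1)) ℕ) :
    reversalMatrix d * M = M.submatrix Fin.rev id :=
  PEquiv.toMatrix_toPEquiv_mul _ _

theorem mul_reversalMatrix (M : Matrix (Fin (d + 1)) (Fin (d + 1)) ℕ) :
    M * reversalMatrix d = M.submatrix id Fin.rev :=
  PEquiv.mul_toMatrix_toPEquiv _ _

theorem reversalMatrix_mul_self : reversalMatrix d * reversalMatrix d = 1 := by
  have hrev : (Fin.revPerm * Fin.revPerm : Equiv.Perm (Fin (d + 1))) = 1 := by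
    ext i
    simp
  rw [reversalMatrix, ← Matrix.permMatrix_mul, hrev, Matrix.permMatrix_one]

theorem sum_range_multichoose_eq_multichoose_succ (a n : ℕ) :
    ∑ i ∈ Finset.range (n + 1), Nat.multichoose a i = Nat.multichoose (a + 1) n := by
  rw [Nat.sum_range_multichoose, Nat.multichoose_eq, Nat.add_right_comm, Nat.add_sub_cancel,
    Nat.add_comm, Nat.choose_symm_add]

theorem zetaMatrix_pow_apply (a : ℕ) (i j : Fin (d + 1)) :
    (zetaMatrix (Fin (d + 1)) ^ a) i j = if i ≤ j then Nat.multichoose a (j - i) else 0 := by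
  induction a generalizing i with
  | zero =>
    rw [pow_zero, Matrix.one_apply]
    rcases lt_trichotomy i j with h | rfl | h
    · obtain ⟨n, hn⟩ := Nat.exists_eq_add_of_lt h
      rw [if_neg h.ne, if_pos h.le, hn, Nat.add_assoc, Nat.add_sub_cancel_left,
        Nat.multichoose_zero_succ]
    · simp
    · rw [if_neg h.ne', if_neg h.not_ge]
  | succ a ih =>
    rw [pow_succ', Matrix.mul_apply]
    simp only [ih]
    simp only [zetaMatrix, Matrix.of_apply, ite_mul, one_mul, zero_mul, ← ite_and,
      ← Finset.sum_filter]
    split_ifs with h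
    · rw [← sum_range_multichoose_eq_multichoose_succ]
      refine Finset.sum_bij' (fun k _ => (j : ℕ) - k) (fun l _ => ⟨j - l, by omega⟩) ?_ ?_ ?_ ?_ ?_
        <;> simp only [Finset.mem_filter, Finset.mem_univ, Finset.mem_range, true_and, Fin.le_def]
          <;> grind
    · exact Finset.sum_eq_zero fun k hk =>
        absurd ((Finset.mem_filter.1 hk).2.1.trans (Finset.mem_filter.1 hk).2.2) h

theorem multichooseMatrix_eq (a : ℕ) :
    multichooseMatrix d a = zetaMatrix (Fin (d + 1)) ^ a * reversalMatrix d := by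
  ext i j
  rw [mul_reversalMatrix, Matrix.submatrix_apply, id, zetaMatrix_pow_apply, multichooseMatrix,
    Matrix.of_apply]
  have hj := j.is_lt
  simp only [Fin.le_def, Fin.val_rev]
  grind

theorem arrowMatrix_not (b : Bool) :
    arrowMatrix (Fin (d + 1)) (!b) =
      reversalMatrix d * arrowMatrix (Fin (d + 1)) b * reversalMatrix d := by
  rw [mul_reversalMatrix, reversalMatrix_mul]
  ext i j
  cases b <;> simp [arrowMatrix, zetaMatrix]

theorem stringMatrix_map_not (u : List Bool) :
    stringMatrix (Fin (d + 1)) (u.map not) =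
      reversalMatrix d * stringMatrix (Fin (d + 1)) u * reversalMatrix d := by
  induction u with
  | nil => simp [stringMatrix, reversalMatrix_mul_self]
  | cons b u ih =>
    have hJ := reversalMatrix_mul_self d
    simp only [stringMatrix, List.map_cons, List.prod_cons, arrowMatrix_not] at ih ⊢
    rw [ih]
    simp only [mul_assoc]
    rw [← mul_assoc _ _ (List.prod _ * _), hJ, one_mul]

theorem sum_stringMatrix_map_not (u : List Bool) :
    ∑ i, ∑ j, stringMatrix (Fin (d + 1)) (u.map not) i j =
      ∑ i, ∑ j, stringMatrix (Fin (d + 1)) u i j := by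
  simp only [stringMatrix_map_not, mul_reversalMatrix, reversalMatrix_mul, Matrix.submatrix_apply,
    id]
  rw [← Equiv.sum_comp Fin.revPerm]
  refine Finset.sum_congr rfl fun i _ => ?_
  rw [← Equiv.sum_comp Fin.revPerm]
  simp

end MultichooseMatrix

section SignSequence

theorem signSequence_not (a : List ℕ) (b : Bool) :
    signSequence a (!b) = (signSequence a b).map not := by
  induction a generalizing b with
  | nil => rfl
  | cons k a ih => simp only [signSequence, List.map_append, List.map_replicate, ih]

theorem eq_of_mem_head?_signSequence {a : List ℕ} (hpos : ∀ k ∈ a, 0 < k) {b x : Bool}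
    (hx : x ∈ (signSequence a b).head?) : x = b := by
  cases a with
  | nil => simp [signSequence] at hx
  | cons k a =>
    obtain ⟨n, rfl⟩ := Nat.exists_eq_succ_of_ne_zero (hpos k List.mem_cons_self).ne'
    simpa [signSequence, List.replicate_succ, eq_comm] using hx

theorem signSequence_eq_nil_iff {a : List ℕ} (hpos : ∀ k ∈ a, 0 < k) {b : Bool} :
    signSequence a b = [] ↔ a = [] := by
  cases a with
  | nil => simp [signSequence]
  | cons k a => simp [signSequence, (hpos k List.mem_cons_self).ne']

theorem eq_of_mem_getLast?_signSequence {a : List ℕ} (hpos : ∀ k ∈ a, 0 < k) {b y : Bool}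
    (hy : y ∈ (signSequence a b).getLast?) : y = (b == a.length.bodd) := by
  induction a generalizing b with
  | nil => simp [signSequence] at hy
  | cons k a ih =>
    have hpos' : ∀ k ∈ a, 0 < k := fun k hk => hpos k (List.mem_cons_of_mem _ hk)
    rw [signSequence] at hy
    rcases eq_or_ne a [] with rfl | ha
    · have hk := (hpos k List.mem_cons_self).ne'
      obtain rfl : b = y := by simpa [signSequence, List.getLast?_replicate, hk] using hy
      simp
    · have hne : signSequence a (!b) ≠ [] := mt (signSequence_eq_nil_iff hpos').1 ha
      rw [List.getLast?_append_of_ne_nil _ hne] at hy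
      rw [ih hpos' hy, List.length_cons, Nat.bodd_succ]
      cases b <;> cases a.length.bodd <;> rfl

variable (d : ℕ)

theorem prod_multichooseMatrix_eq (a : List ℕ) :
    (a.map (multichooseMatrix d)).prod =
      stringMatrix (Fin (d + 1)) (signSequence a true) * reversalMatrix d ^ a.length := by
  induction a with
  | nil => simp [signSequence, stringMatrix]
  | cons k a ih =>
    have hJ : ∀ M, reversalMatrix d * (reversalMatrix d * M) = M := fun M => by
      rw [← mul_assoc, reversalMatrix_mul_self, one_mul]
    have hsplit : stringMatrix (Fin (d + 1)) (signSequence (k :: a) true) =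
        zetaMatrix (Fin (d + 1)) ^ k * stringMatrix (Fin (d + 1)) (signSequence a (!true)) := by
      simp [signSequence, stringMatrix, arrowMatrix]
    rw [List.map_cons, List.prod_cons, ih, hsplit, signSequence_not, stringMatrix_map_not,
      multichooseMatrix_eq, List.length_cons, pow_succ']
    simp only [mul_assoc, hJ]

theorem zetaMatrix_mul_apply_zero (M : Matrix (Fin (d + 1)) (Fin (d + 1)) ℕ) (j : Fin (d + 1)) :
    (zetaMatrix (Fin (d + 1)) * M) 0 j = ∑ i, M i j := by
  simp [Matrix.mul_apply, zetaMatrix]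

theorem arrowMatrix_mul_reversalMatrix_pow_apply_zero (n : ℕ) (i : Fin (d + 1)) :
    (arrowMatrix (Fin (d + 1)) n.bodd * reversalMatrix d ^ n) i 0 = 1 := by
  induction n generalizing i with
  | zero => simp [arrowMatrix, zetaMatrix]
  | succ n ih =>
    rw [Nat.bodd_succ, arrowMatrix_not, pow_succ', mul_assoc, ← mul_assoc (reversalMatrix d),
      reversalMatrix_mul_self, one_mul, mul_assoc, reversalMatrix_mul]
    exact ih i.rev

theorem prod_multichooseMatrix_apply_zero_zero {a : List ℕ} (hpos : ∀ k ∈ a, 0 < k) {b x y : Bool}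
    {l : List Bool} (h : signSequence a b = x :: (l ++ [y])) :
    (a.map (multichooseMatrix d)).prod 0 0 = ∑ i, ∑ j, stringMatrix (Fin (d + 1)) l i j := by
  wlog hb : b = true generalizing b x y l
  · rw [← sum_stringMatrix_map_not]
    refine this (b := !b) (x := !x) (y := !y) ?_ (by simpa using hb)
    simp only [signSequence_not, h, List.map_cons, List.map_append, List.map_nil]
  subst hb
  have hx : x = true := eq_of_mem_head?_signSequence hpos (b := true) (by simp [h])
  have hy : y = a.length.bodd := by
    simpa using eq_of_mem_getLast?_signSequence hpos (b := true) (y := y)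
      (by rw [h, ← List.cons_append, List.getLast?_concat]; rfl)
  have hsplit : stringMatrix (Fin (d + 1)) (true :: (l ++ [a.length.bodd])) =
      zetaMatrix (Fin (d + 1)) *
        (stringMatrix (Fin (d + 1)) l * arrowMatrix (Fin (d + 1)) a.length.bodd) := by
    simp [stringMatrix, arrowMatrix]
  rw [prod_multichooseMatrix_eq, h, hx, hy, hsplit, mul_assoc, mul_assoc,
    zetaMatrix_mul_apply_zero]
  simp only [Matrix.mul_apply (M := stringMatrix _ _),
    arrowMatrix_mul_reversalMatrix_pow_apply_zero, mul_one]

end SignSequence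

/-! ### Higher continued fractions -/

section HigherCF

variable (d : ℕ)

theorem higherCFNum_cons (k : ℕ) {a : List ℕ} (ha : a ≠ []) (i : ℕ) :
    higherCFNum d (k :: a) i =
      ∑ j ∈ Finset.range (i + 1), Nat.multichoose k (i - j) * higherCFNum d a (d - j) := by
  cases a with
  | nil => exact absurd rfl ha
  | cons b l => rw [higherCFNum, Finset.sum_range_eq_add_Ico _ (Nat.succ_pos i)]; rfl

theorem higherCFDen_eq_higherCFNum_tail {a : List ℕ} (ha : a.tail ≠ []) :
    higherCFDen d a = higherCFNum d a.tail d := by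
  match a, ha with
  | _ :: _ :: _, _ => rfl

theorem sum_multichooseMatrix_mul (k : ℕ) (i : Fin (d + 1)) (v : ℕ → ℕ) :
    ∑ j : Fin (d + 1), multichooseMatrix d k i j * v j =
      ∑ j ∈ Finset.range (d - i + 1), Nat.multichoose k (d - i - j) * v j := by
  simp only [multichooseMatrix, Matrix.of_apply]
  rw [Fin.sum_univ_eq_sum_range
    fun j => (if (i : ℕ) + j ≤ d then Nat.multichoose k (d - i - j) else 0) * v j]
  symm
  refine Finset.sum_subset_zero_on_sdiff (by gcongr; omega) (fun j hj => ?_) fun j hj => ?_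
  · simp only [Finset.mem_sdiff, Finset.mem_range] at hj
    rw [if_neg (by omega), zero_mul]
  · rw [if_pos (by have := Finset.mem_range.1 hj; omega)]

theorem prod_multichooseMatrix_apply_zero {a : List ℕ} (ha : a ≠ []) (i : Fin (d + 1)) :
    (a.map (multichooseMatrix d)).prod i 0 = higherCFNum d a (d - i) := by
  induction a generalizing i with
  | nil => exact absurd rfl ha
  | cons k a ih =>
    rcases eq_or_ne a [] with rfl | ha
    · simp [multichooseMatrix, higherCFNum, Nat.lt_succ_iff.1 i.is_lt]
    · simp only [List.map_cons, List.prod_cons, Matrix.mul_apply, ih ha, higherCFNum_cons d k ha]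
      exact sum_multichooseMatrix_mul d k i fun j => higherCFNum d a (d - j)

theorem higherCFNum_pos {a : List ℕ} (hpos : ∀ k ∈ a, 0 < k) (i : ℕ) :
    0 < higherCFNum d a i := by
  have multichoose_pos {k : ℕ} (hk : 0 < k) : 0 < Nat.multichoose k i := by
    rw [Nat.multichoose_eq]
    exact Nat.choose_pos (by omega)
  match a with
  | [] => exact one_pos
  | [k] => exact multichoose_pos (hpos k List.mem_cons_self)
  | k :: b :: l =>
    exact Nat.add_pos_left (Nat.mul_pos (multichoose_pos (hpos k List.mem_cons_self))
      (higherCFNum_pos (fun k hk => hpos k (List.mem_cons_of_mem _ hk)) d)) _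

theorem higherCFDen_pos {a : List ℕ} (hpos : ∀ k ∈ a, 0 < k) : 0 < higherCFDen d a := by
  match a with
  | [] | [_] => exact one_pos
  | _ :: b :: l => exact higherCFNum_pos d (fun k hk => hpos k (List.mem_cons_of_mem _ hk)) d

theorem higherCF_eq_num_div_den {a : List ℕ} (hpos : ∀ k ∈ a, 0 < k) (i : ℕ) :
    higherCF d a i = (higherCFNum d a i : ℚ) / (higherCFDen d a : ℚ) := by
  match a with
  | [] | [_] => simp [higherCF, higherCFNum, higherCFDen]
  | k :: b :: l =>
    have hpos' : ∀ k ∈ b :: l, 0 < k := fun k hk => hpos k (List.mem_cons_of_mem _ hk)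
    have hden : (higherCFDen d (b :: l) : ℚ) ≠ 0 := mod_cast (higherCFDen_pos d hpos').ne'
    have hnum : (higherCFNum d (b :: l) d : ℚ) ≠ 0 := mod_cast (higherCFNum_pos d hpos' d).ne'
    rw [higherCFDen, higherCF, higherCFNum, eq_div_iff hnum]
    push_cast
    rw [add_mul, Finset.sum_mul]
    congr 1
    refine Finset.sum_congr rfl fun j _ => ?_
    rw [higherCF_eq_num_div_den hpos', higherCF_eq_num_div_den hpos']
    field_simp

end HigherCF

/-! ### Signs and letters along a snake graph -/

/-- The other direction. -/
def SnakeStep.flip : SnakeStep → SnakeStep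
  | right => up
  | up => right

/-- The displacement of a tile from the previous one. -/
def SnakeStep.vec : SnakeStep → ℕ × ℕ
  | right => (1, 0)
  | up => (0, 1)

/-- The direction that gives an inverse letter when it is taken from the tile `i`. -/
def labelStep (i : ℕ) : SnakeStep :=
  SnakeStep.flip^[i] .up

/-- The side through which the tile `i` is left in direction `q`. -/
def exitSide (s : List SnakeStep) (i : ℕ) (q : SnakeStep) : Sym2 (ℕ × ℕ) :=
  s(tileCorner s i + q.vec, tileCorner s i + (1, 1))

/-- The side through which the tile `i` is entered in direction `q`. -/
def entrySide (s : List SnakeStep) (i : ℕ) (q : SnakeStep) : Sym2 (ℕ × ℕ) :=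
  s(tileCorner s i, tileCorner s i + q.flip.vec)

theorem SnakeStep.flip_flip (q : SnakeStep) : q.flip.flip = q := by
  cases q <;> rfl

theorem SnakeStep.eq_flip_of_ne {p q : SnakeStep} (h : p ≠ q) : p = q.flip := by
  cases p <;> cases q <;> first | rfl | exact absurd rfl h

theorem SnakeStep.vec_add_vec_flip (q : SnakeStep) : q.vec + q.flip.vec = (1, 1) := by
  cases q <;> rfl

theorem labelStep_succ (i : ℕ) : labelStep (i + 1) = (labelStep i).flip :=
  Function.iterate_succ_apply' _ _ _

theorem abstractStringAux_eq_mapIdx (p r : SnakeStep) (l : List SnakeStep) :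
    abstractStringAux p (decide (p ≠ r)) l =
      l.mapIdx fun i q => decide (q ≠ SnakeStep.flip^[i + 1] r) := by
  induction l generalizing p r with
  | nil => simp only [abstractStringAux, List.mapIdx_nil]
  | cons q l ih =>
    have hletter : (if q = p then !decide (p ≠ r) else decide (p ≠ r)) = decide (q ≠ r.flip) := by
      cases p <;> cases q <;> cases r <;> rfl
    rw [abstractStringAux, List.mapIdx_cons]
    simp only [hletter, ih]
    rfl

theorem abstractString_eq_mapIdx (s : List SnakeStep) :
    abstractString s = s.mapIdx fun i q => decide (q ≠ labelStep i) := by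
  cases s with
  | nil => rfl
  | cons p l =>
    have hletter : decide (p = SnakeStep.right) = decide (p ≠ SnakeStep.up) := by
      cases p <;> rfl
    rw [abstractString, hletter, abstractStringAux_eq_mapIdx, List.mapIdx_cons]
    rfl

theorem abstractString_concat (s : List SnakeStep) (q : SnakeStep) :
    abstractString (s ++ [q]) = abstractString s ++ [decide (q ≠ labelStep s.length)] := by
  simp only [abstractString_eq_mapIdx, List.mapIdx_concat]

theorem tileCorner_succ (s : List SnakeStep) (i : Fin s.length) :
    tileCorner s (i + 1) = tileCorner s i + (s.get i).vec := by
  simp only [tileCorner, List.take_add_one, List.getElem?_eq_getElem i.isLt, Option.toList_some,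
    List.count_append, List.get_eq_getElem]
  cases s[(i : ℕ)] <;> rfl

theorem entrySide_succ (s : List SnakeStep) (i : Fin s.length) :
    entrySide s (i + 1) (s.get i) = exitSide s i (s.get i) := by
  rw [entrySide, exitSide, tileCorner_succ, add_assoc, SnakeStep.vec_add_vec_flip]

theorem interiorEdge_eq_exitSide (s : List SnakeStep) (i : Fin s.length) :
    interiorEdge s i = exitSide s i (s.get i) := by
  rw [interiorEdge]
  cases s.get i <;> rfl

section SignFunction

variable {s : List SnakeStep} {f : Sym2 (ℕ × ℕ) → Bool} {i : ℕ}

theorem IsSignFunction.exitSide_flip_ne (hf : IsSignFunction s f) (hi : i ≤ s.length)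
    (q : SnakeStep) : f (exitSide s i q.flip) ≠ f (exitSide s i q) := by
  obtain ⟨-, hsouth, hne⟩ := hf i hi
  rw [hsouth] at hne
  cases q
  · exact hne
  · exact hne.symm

theorem IsSignFunction.entrySide_eq (hf : IsSignFunction s f) (hi : i ≤ s.length)
    (q : SnakeStep) : f (entrySide s i q) = f (exitSide s i q.flip) := by
  obtain ⟨hnorth, hsouth, -⟩ := hf i hi
  cases q
  · exact hnorth.symm
  · exact hsouth

theorem IsSignFunction.exitSide_succ_flip (hf : IsSignFunction s f) (hi : i < s.length)
    (q : SnakeStep) : f (exitSide s (i + 1) q.flip) = f (exitSide s i q) := by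
  have hstep : ∀ p, p = s.get ⟨i, hi⟩ → f (exitSide s (i + 1) p.flip) = f (exitSide s i p) := by
    rintro _ rfl
    rw [← hf.entrySide_eq hi, entrySide_succ s ⟨i, hi⟩]
  by_cases hq : q = s.get ⟨i, hi⟩
  · exact hstep q hq
  · have hflip := hstep q.flip (by rw [SnakeStep.eq_flip_of_ne hq, SnakeStep.flip_flip])
    have hi_ne := hf.exitSide_flip_ne hi.le q
    have hsucc_ne := hf.exitSide_flip_ne hi q.flip
    rw [hflip] at hsucc_ne
    exact (Bool.eq_not.2 hsucc_ne.symm).trans (Bool.eq_not.2 hi_ne.symm).symm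

theorem IsSignFunction.exitSide_labelStep (hf : IsSignFunction s f) (hi : i ≤ s.length) :
    f (exitSide s i (labelStep i)) = f (northSide s 0) := by
  induction i with
  | zero => rfl
  | succ i ih => rw [labelStep_succ, hf.exitSide_succ_flip hi, ih (Nat.le_of_succ_le hi)]

theorem IsSignFunction.exitSide_eq_xor (hf : IsSignFunction s f) (hi : i ≤ s.length)
    (q : SnakeStep) : f (exitSide s i q) = (f (northSide s 0) ^^ decide (q ≠ labelStep i)) := by
  rw [← hf.exitSide_labelStep hi]
  by_cases hq : q = labelStep i
  · simp [hq]
  · have hne := hf.exitSide_flip_ne hi (labelStep i)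
    rw [← SnakeStep.eq_flip_of_ne hq] at hne
    simpa [hq] using Bool.eq_not.2 hne

theorem IsSignFunction.ofFn_interiorEdge (hf : IsSignFunction s f) :
    List.ofFn (fun i => f (interiorEdge s i)) =
      (abstractString s).map (f (northSide s 0) ^^ ·) := by
  refine List.ext_getElem (by simp [abstractString_eq_mapIdx]) fun i h _ => ?_
  have hi : i < s.length := by simpa using h
  simp [interiorEdge_eq_exitSide, abstractString_eq_mapIdx, hf.exitSide_eq_xor hi.le]

end SignFunction

theorem IsSnakeGraphOfCF.ne_nil {s : List SnakeStep} {a : List ℕ} (h : IsSnakeGraphOfCF s a) :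
    a ≠ [] := by
  rintro rfl
  obtain ⟨-, _, -, _, _, -, -, _, hsigns⟩ := h
  exact List.cons_ne_nil _ _ hsigns.symm

theorem IsSnakeGraphOfCF.ncard_monotoneLabelings {s : List SnakeStep} {a : List ℕ}
    (h : IsSnakeGraphOfCF s a) (d : ℕ) :
    (monotoneLabelings (Fin (d + 1)) (abstractString s)).ncard =
      (a.map (multichooseMatrix d)).prod 0 0 := by
  obtain ⟨hpos, f, hf, _, _, -, -, _, hsigns⟩ := h
  rw [prod_multichooseMatrix_apply_zero_zero d hpos hsigns, hf.ofFn_interiorEdge,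
    _root_.ncard_monotoneLabelings]
  cases f (northSide s 0)
  · simp
  · have hnot : (true ^^ ·) = not := funext Bool.true_xor
    rw [hnot, sum_stringMatrix_map_not]

/-! ### Dimer covers -/

theorem mem_support_iff_exists_mem_edgeSet {W : Type*} {G : SimpleGraph W} {v : W} :
    v ∈ G.support ↔ ∃ e ∈ G.edgeSet, v ∈ e := by
  rw [SimpleGraph.mem_support]
  constructor
  · rintro ⟨w, h⟩
    exact ⟨s(v, w), h, Sym2.mem_mk_left v w⟩
  · rintro ⟨e, he, w, rfl⟩
    exact ⟨w, he⟩

theorem countP_mem_replicate {W : Type*} [DecidableEq W] (v x y : W) (n : ℕ) :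
    (Multiset.replicate n s(x, y)).countP (v ∈ ·) = if v = x ∨ v = y then n else 0 := by
  rw [← Multiset.coe_replicate, Multiset.coe_countP, List.countP_replicate]
  simp

theorem count_le_of_mem_dimerCovers {W : Type*} [DecidableEq W] {G : SimpleGraph W} {d : ℕ}
    {D : Multiset (Sym2 W)} (hD : D ∈ dimerCovers G d) {e : Sym2 W} (he : e ∈ G.edgeSet) :
    D.count e ≤ d := by
  have hsub : Multiset.replicate (D.count e) e ≤ D.filter (e.out.1 ∈ ·) :=
    Multiset.le_filter.2 ⟨Multiset.le_count_iff_replicate_le.1 le_rfl, fun e' he' => by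
      rw [Multiset.eq_of_mem_replicate he']; exact e.out_fst_mem⟩
  calc D.count e = (Multiset.replicate (D.count e) e).card := (Multiset.card_replicate _ _).symm
    _ ≤ (D.filter (e.out.1 ∈ ·)).card := Multiset.card_le_card hsub
    _ = D.countP (e.out.1 ∈ ·) := (Multiset.countP_eq_card_filter _ _).symm
    _ = d := hD.2 _ (mem_support_iff_exists_mem_edgeSet.2 ⟨e, he, e.out_fst_mem⟩)

theorem finite_dimerCovers {W : Type*} [DecidableEq W] {G : SimpleGraph W}
    (hG : G.edgeSet.Finite) (d : ℕ) : (dimerCovers G d).Finite := by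
  refine (Set.finite_Iic (d • hG.toFinset.val)).subset fun D hD =>
    Multiset.le_iff_count.2 fun e => ?_
  by_cases he : e ∈ G.edgeSet
  · have hcount : hG.toFinset.val.count e = 1 :=
      Multiset.count_eq_one_of_mem hG.toFinset.nodup (hG.mem_toFinset.2 he)
    rw [Multiset.count_nsmul, hcount, mul_one]
    exact count_le_of_mem_dimerCovers hD he
  · rw [Multiset.count_eq_zero_of_notMem fun h => he (hD.1 e h)]
    exact Nat.zero_le _

theorem dimerCovers_edge {W : Type*} [DecidableEq W] {a b : W} (hab : a ≠ b) (d : ℕ) :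
    dimerCovers (SimpleGraph.edge a b) d = {Multiset.replicate d s(a, b)} := by
  have ha : a ∈ (SimpleGraph.edge a b).support :=
    ⟨b, (SimpleGraph.edge_adj a b a b).2 ⟨Or.inl ⟨rfl, rfl⟩, hab⟩⟩
  ext D
  rw [Set.mem_singleton_iff]
  constructor
  · rintro ⟨hedge, hcount⟩
    rw [SimpleGraph.edgeSet_edge_of_ne hab] at hedge
    have hD := Multiset.eq_replicate_card.2 hedge
    have := hcount a ha
    rw [hD, countP_mem_replicate, if_pos (Or.inl rfl)] at this
    rw [hD, this]
  · rintro rfl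
    refine ⟨fun e he => ?_, fun v hv => ?_⟩
    · rw [SimpleGraph.edgeSet_edge_of_ne hab]
      exact Multiset.eq_of_mem_replicate he
    · rw [countP_mem_replicate, if_pos]
      obtain ⟨e, he, hve⟩ := mem_support_iff_exists_mem_edgeSet.1 hv
      rw [SimpleGraph.edgeSet_edge_of_ne hab, Set.mem_singleton_iff] at he
      rwa [he, Sym2.mem_iff] at hve

/-- `G'` arises from `G` by gluing a square with corners `a, b, b', a'` along the edge `ab`. -/
structure IsSquareExtension {W : Type*} (G G' : SimpleGraph W) (a b a' b' : W) : Prop where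
  adj : G.Adj a b
  left_notMem : a' ∉ G.support
  right_notMem : b' ∉ G.support
  ne : a' ≠ b'
  mem_edgeSet : ∀ e, e ∈ G'.edgeSet ↔
    e ∈ G.edgeSet ∨ e = s(a, a') ∨ e = s(b, b') ∨ e = s(a', b')

namespace IsSquareExtension

variable {W : Type*} {G G' : SimpleGraph W} {a b a' b' : W}

theorem notMem_edge (h : IsSquareExtension G G' a b a' b') {e : Sym2 W} (he : e ∈ G.edgeSet) :
    a' ∉ e ∧ b' ∉ e :=
  ⟨fun h' => h.left_notMem (mem_support_iff_exists_mem_edgeSet.2 ⟨e, he, h'⟩),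
    fun h' => h.right_notMem (mem_support_iff_exists_mem_edgeSet.2 ⟨e, he, h'⟩)⟩

theorem corners_ne (h : IsSquareExtension G G' a b a' b') :
    a ≠ b ∧ a ≠ a' ∧ a ≠ b' ∧ b ≠ a' ∧ b ≠ b' := by
  have hab := h.notMem_edge ((SimpleGraph.mem_edgeSet G).2 h.adj)
  simp only [Sym2.mem_iff, not_or] at hab
  exact ⟨h.adj.ne, Ne.symm hab.1.1, Ne.symm hab.2.1, Ne.symm hab.1.2, Ne.symm hab.2.2⟩

theorem mem_support (h : IsSquareExtension G G' a b a' b') (v : W) :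
    v ∈ G'.support ↔ v ∈ G.support ∨ v = a' ∨ v = b' := by
  have ha : a ∈ G.support := ⟨b, h.adj⟩
  have hb : b ∈ G.support := ⟨a, h.adj.symm⟩
  simp only [mem_support_iff_exists_mem_edgeSet, h.mem_edgeSet] at ha hb ⊢
  constructor
  · rintro ⟨e, he | rfl | rfl | rfl, hv⟩
    · exact Or.inl ⟨e, he, hv⟩
    all_goals
      rcases Sym2.mem_iff.1 hv with rfl | rfl <;> simp only [ha, hb, true_or, or_true]
  · rintro (⟨e, he, hv⟩ | rfl | rfl)
    · exact ⟨e, Or.inl he, hv⟩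
    · exact ⟨s(a, v), Or.inr (Or.inl rfl), Sym2.mem_mk_right a v⟩
    · exact ⟨s(b, v), Or.inr (Or.inr (Or.inl rfl)), Sym2.mem_mk_right b v⟩

end IsSquareExtension

/-- The sides `aa'`, `bb'` and `a'b'` of a square with corners `a, b, b', a'`, with
multiplicities `x`, `y` and `z`. -/
def newSides {W : Type*} (a b a' b' : W) (x y z : ℕ) : Multiset (Sym2 W) :=
  Multiset.replicate x s(a, a') + Multiset.replicate y s(b, b') + Multiset.replicate z s(a', b')

theorem countP_mem_newSides {W : Type*} [DecidableEq W] (a b a' b' v : W) (x y z : ℕ) :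
    (newSides a b a' b' x y z).countP (v ∈ ·) =
      (if v = a ∨ v = a' then x else 0) + (if v = b ∨ v = b' then y else 0) +
        if v = a' ∨ v = b' then z else 0 := by
  simp only [newSides, Multiset.countP_add, countP_mem_replicate]

namespace IsSquareExtension

variable {W : Type*} {G G' : SimpleGraph W} {a b a' b' : W}

theorem exists_eq_add_newSides (h : IsSquareExtension G G' a b a' b') (D : Multiset (Sym2 W))
    (hD : ∀ e ∈ D, e ∈ G'.edgeSet) :
    ∃ E x y z, (∀ e ∈ E, e ∈ G.edgeSet) ∧ D = E + newSides a b a' b' x y z := by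
  induction D using Multiset.induction with
  | empty => exact ⟨0, 0, 0, 0, fun e he => absurd he (Multiset.notMem_zero e), rfl⟩
  | cons e D ih =>
    obtain ⟨E, x, y, z, hE, rfl⟩ := ih fun e he => hD e (Multiset.mem_cons_of_mem he)
    rcases (h.mem_edgeSet e).1 (hD e (Multiset.mem_cons_self e _)) with he | rfl | rfl | rfl
    · exact ⟨e ::ₘ E, x, y, z, Multiset.forall_mem_cons.2 ⟨he, hE⟩,
        (Multiset.cons_add e E _).symm⟩
    · exact ⟨E, x + 1, y, z, hE, by
        simp only [newSides, Multiset.replicate_succ, Multiset.cons_add, Multiset.add_cons]⟩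
    · exact ⟨E, x, y + 1, z, hE, by
        simp only [newSides, Multiset.replicate_succ, Multiset.cons_add, Multiset.add_cons]⟩
    · exact ⟨E, x, y, z + 1, hE, by
        simp only [newSides, Multiset.replicate_succ, Multiset.add_cons]⟩

theorem forall_mem_edgeSet_add_newSides (h : IsSquareExtension G G' a b a' b')
    {E : Multiset (Sym2 W)} (hE : ∀ e ∈ E, e ∈ G.edgeSet) (x y z : ℕ) :
    ∀ e ∈ E + newSides a b a' b' x y z, e ∈ G'.edgeSet := by
  intro e he
  simp only [newSides, Multiset.mem_add] at he
  rw [h.mem_edgeSet]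
  rcases he with he | (he | he) | he
  · exact Or.inl (hE e he)
  · exact Or.inr (Or.inl (Multiset.eq_of_mem_replicate he))
  · exact Or.inr (Or.inr (Or.inl (Multiset.eq_of_mem_replicate he)))
  · exact Or.inr (Or.inr (Or.inr (Multiset.eq_of_mem_replicate he)))

variable [DecidableEq W]

theorem countP_left_eq_zero (h : IsSquareExtension G G' a b a' b') {E : Multiset (Sym2 W)}
    (hE : ∀ e ∈ E, e ∈ G.edgeSet) : E.countP (a' ∈ ·) = 0 :=
  Multiset.countP_eq_zero.2 fun e he => (h.notMem_edge (hE e he)).1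

theorem countP_right_eq_zero (h : IsSquareExtension G G' a b a' b') {E : Multiset (Sym2 W)}
    (hE : ∀ e ∈ E, e ∈ G.edgeSet) : E.countP (b' ∈ ·) = 0 :=
  Multiset.countP_eq_zero.2 fun e he => (h.notMem_edge (hE e he)).2

theorem countP_add_newSides (h : IsSquareExtension G G' a b a' b') (E : Multiset (Sym2 W))
    (x z : ℕ) {v : W} (hv : v ∈ G.support) :
    (E + newSides a b a' b' x x z).countP (v ∈ ·) =
      (E + Multiset.replicate x s(a, b)).countP (v ∈ ·) := by
  obtain ⟨hab, -⟩ := h.corners_ne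
  have hva : v ≠ a' := fun h' => h.left_notMem (h' ▸ hv)
  have hvb : v ≠ b' := fun h' => h.right_notMem (h' ▸ hv)
  simp only [Multiset.countP_add, countP_mem_newSides, countP_mem_replicate, hva, hvb, or_false,
    if_false, add_zero]
  by_cases h1 : v = a
  · simp only [h1, hab, true_or, if_true, if_false, add_zero]
  · simp only [h1, false_or, if_false, zero_add]

theorem add_newSides_mem_dimerCovers_iff (h : IsSquareExtension G G' a b a' b') {d x y z : ℕ}
    {E : Multiset (Sym2 W)} (hE : ∀ e ∈ E, e ∈ G.edgeSet) :
    E + newSides a b a' b' x y z ∈ dimerCovers G' d ↔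
      x = y ∧ x + z = d ∧ E + Multiset.replicate x s(a, b) ∈ dimerCovers G d := by
  obtain ⟨-, haa', hab', hba', hbb'⟩ := h.corners_ne
  have hleft : (E + newSides a b a' b' x y z).countP (a' ∈ ·) = x + z := by
    simp only [Multiset.countP_add, h.countP_left_eq_zero hE, countP_mem_newSides, haa'.symm,
      hba'.symm, h.ne, or_true, or_false, if_true, if_false, zero_add, add_zero]
  have hright : (E + newSides a b a' b' x y z).countP (b' ∈ ·) = y + z := by
    simp only [Multiset.countP_add, h.countP_right_eq_zero hE, countP_mem_newSides, hab'.symm,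
      hbb'.symm, h.ne.symm, or_true, or_false, if_true, if_false, zero_add]
  have hedges : ∀ e ∈ E + Multiset.replicate x s(a, b), e ∈ G.edgeSet := fun e he =>
    (Multiset.mem_add.1 he).elim (hE e) fun he => Multiset.eq_of_mem_replicate he ▸ h.adj
  constructor
  · intro hD
    have hxz := hleft.symm.trans (hD.2 a' ((h.mem_support a').2 (Or.inr (Or.inl rfl))))
    have hyz := hright.symm.trans (hD.2 b' ((h.mem_support b').2 (Or.inr (Or.inr rfl))))
    obtain rfl : x = y := by omega
    exact ⟨rfl, hxz, hedges, fun v hv => (h.countP_add_newSides E x z hv).symm.trans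
      (hD.2 v ((h.mem_support v).2 (Or.inl hv)))⟩
  · rintro ⟨rfl, hxz, hD⟩
    refine ⟨h.forall_mem_edgeSet_add_newSides hE x x z, fun v hv => ?_⟩
    rcases (h.mem_support v).1 hv with hv | rfl | rfl
    · exact (h.countP_add_newSides E x z hv).trans (hD.2 v hv)
    · exact hleft.trans hxz
    · exact hright.trans hxz

theorem count_add_newSides (h : IsSquareExtension G G' a b a' b') {E : Multiset (Sym2 W)}
    (hE : ∀ e ∈ E, e ∈ G.edgeSet) (x y z : ℕ) :
    (E + newSides a b a' b' x y z).count s(b, b') = y ∧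
      (E + newSides a b a' b' x y z).count s(a', b') = z := by
  obtain ⟨hab, haa', hab', hba', hbb'⟩ := h.corners_ne
  have hbb'_notMem : s(b, b') ∉ E := fun he =>
    (h.notMem_edge (hE _ he)).2 (Sym2.mem_mk_right b b')
  have ha'b'_notMem : s(a', b') ∉ E := fun he =>
    (h.notMem_edge (hE _ he)).2 (Sym2.mem_mk_right a' b')
  simp [newSides, Multiset.count_replicate, Multiset.count_eq_zero_of_notMem hbb'_notMem,
    Multiset.count_eq_zero_of_notMem ha'b'_notMem, hab, haa', hab', hba', hbb', hba'.symm, h.ne]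

theorem count_add_count (h : IsSquareExtension G G' a b a' b') {d : ℕ} {D : Multiset (Sym2 W)}
    (hD : D ∈ dimerCovers G' d) : D.count s(b, b') + D.count s(a', b') = d := by
  obtain ⟨E, x, y, z, hE, rfl⟩ := h.exists_eq_add_newSides D hD.1
  obtain ⟨rfl, hxz, -⟩ := (h.add_newSides_mem_dimerCovers_iff hE).1 hD
  rw [(h.count_add_newSides hE x x z).1, (h.count_add_newSides hE x x z).2, hxz]

/-- Both sides count the multisets `E` of edges of `G` that become a dimer cover of `G` when `x`
copies of `ab` are added; adding `x` copies of `aa'` and `bb'` instead, one completes them to a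
dimer cover of `G'` with `d - x` copies of `a'b'`. -/
theorem ncard_adjacent (h : IsSquareExtension G G' a b a' b') {d x : ℕ} (hx : x ≤ d) :
    {D ∈ dimerCovers G' d | D.count s(b, b') = x}.ncard =
      {D ∈ dimerCovers G d | x ≤ D.count s(a, b)}.ncard := by
  let S := {E | E + Multiset.replicate x s(a, b) ∈ dimerCovers G d}
  have hS : ∀ E ∈ S, ∀ e ∈ E, e ∈ G.edgeSet := fun E hE e he =>
    hE.1 e (Multiset.mem_add.2 (.inl he))
  have hG' : {D ∈ dimerCovers G' d | D.count s(b, b') = x} =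
      (· + newSides a b a' b' x x (d - x)) '' S := by
    ext D
    constructor
    · rintro ⟨hD, hcount⟩
      obtain ⟨E, x', y, z, hE, rfl⟩ := h.exists_eq_add_newSides D hD.1
      obtain ⟨rfl, hxz, hED⟩ := (h.add_newSides_mem_dimerCovers_iff hE).1 hD
      obtain rfl : x' = x := (h.count_add_newSides hE x' x' z).1.symm.trans hcount
      exact ⟨E, hED, by rw [← hxz, Nat.add_sub_cancel_left]⟩
    · rintro ⟨E, hE, rfl⟩
      exact ⟨(h.add_newSides_mem_dimerCovers_iff (hS E hE)).2 ⟨rfl, Nat.add_sub_of_le hx, hE⟩,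
        (h.count_add_newSides (hS E hE) x x (d - x)).1⟩
  have hG : {D ∈ dimerCovers G d | x ≤ D.count s(a, b)} =
      (· + Multiset.replicate x s(a, b)) '' S := by
    ext D
    constructor
    · rintro ⟨hD, hcount⟩
      obtain ⟨E, rfl⟩ :=
        Multiset.le_iff_exists_add.1 (Multiset.le_count_iff_replicate_le.1 hcount)
      rw [add_comm] at hD ⊢
      exact ⟨E, hD, rfl⟩
    · rintro ⟨E, hE, rfl⟩
      exact ⟨hE, Multiset.le_count_iff_replicate_le.2 (Multiset.le_add_left _ _)⟩
  rw [hG', hG, Set.ncard_image_of_injective S (add_left_injective _),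
    Set.ncard_image_of_injective S (add_left_injective _)]

theorem ncard_opposite (h : IsSquareExtension G G' a b a' b') {d y : ℕ} (hy : y ≤ d) :
    {D ∈ dimerCovers G' d | D.count s(a', b') = y}.ncard =
      {D ∈ dimerCovers G d | d - y ≤ D.count s(a, b)}.ncard := by
  rw [← h.ncard_adjacent (Nat.sub_le d y)]
  congr 1
  ext D
  refine and_congr_right fun hD => ?_
  have := h.count_add_count hD
  omega

end IsSquareExtension

/-! ### Dimer covers of snake graphs -/

theorem tileCorner_append (s t : List SnakeStep) {i : ℕ} (hi : i ≤ s.length) :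
    tileCorner (s ++ t) i = tileCorner s i := by
  rw [tileCorner, tileCorner, List.take_append_of_le_length hi]

theorem tileCorner_concat (s : List SnakeStep) (q : SnakeStep) :
    tileCorner (s ++ [q]) (s.length + 1) = tileCorner s s.length + q.vec := by
  have hlt : s.length < (s ++ [q]).length := by simp
  have hget : (s ++ [q]).get ⟨s.length, hlt⟩ = q := List.getElem_concat_length rfl hlt
  rw [tileCorner_succ (s ++ [q]) ⟨s.length, hlt⟩, hget, tileCorner_append s [q] le_rfl]

theorem tileCorner_mono (s : List SnakeStep) {i j : ℕ} (hij : i ≤ j) :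
    tileCorner s i ≤ tileCorner s j :=
  ⟨(List.take_sublist_take_left hij).count_le _, (List.take_sublist_take_left hij).count_le _⟩

theorem mem_edgeSet_snakeGraph {s : List SnakeStep} {e : Sym2 (ℕ × ℕ)} :
    e ∈ (snakeGraph s).edgeSet ↔
      ∃ i ≤ s.length, ∃ q, e = entrySide s i q ∨ e = exitSide s i q := by
  have hsides (i : ℕ) : (∃ q, e = entrySide s i q ∨ e = exitSide s i q) ↔
      e = southSide s i ∨ e = westSide s i ∨ e = northSide s i ∨ e = eastSide s i := by
    constructor
    · rintro ⟨_ | _, rfl | rfl⟩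
      exacts [.inr (.inl rfl), .inr (.inr (.inr rfl)), .inl rfl, .inr (.inr (.inl rfl))]
    · rintro (h | h | h | h)
      exacts [⟨.up, .inl h⟩, ⟨.right, .inl h⟩, ⟨.up, .inr h⟩, ⟨.right, .inr h⟩]
  simp only [hsides]
  rw [snakeGraph, SimpleGraph.edgeSet_fromEdgeSet, Set.mem_sdiff, Set.mem_ofPred_eq,
    and_iff_left_iff_imp]
  rintro ⟨i, -, rfl | rfl | rfl | rfl⟩ <;>
    simp [southSide, westSide, northSide, eastSide, Prod.ext_iff]

theorem exitSide_mem_edgeSet (s : List SnakeStep) (q : SnakeStep) :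
    exitSide s s.length q ∈ (snakeGraph s).edgeSet :=
  mem_edgeSet_snakeGraph.2 ⟨s.length, le_rfl, q, .inr rfl⟩

theorem finite_edgeSet_snakeGraph (s : List SnakeStep) : (snakeGraph s).edgeSet.Finite := by
  have hsides (i : ℕ) : {e | ∃ q, e = entrySide s i q ∨ e = exitSide s i q}.Finite :=
    (Set.toFinite {entrySide s i .right, exitSide s i .right, entrySide s i .up,
      exitSide s i .up}).subset (by rintro e ⟨_ | _, rfl | rfl⟩ <;> simp)
  refine ((Set.finite_Iic s.length).biUnion fun i _ => hsides i).subset fun e he => ?_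
  obtain ⟨i, hi, hq⟩ := mem_edgeSet_snakeGraph.1 he
  exact Set.mem_biUnion (Set.mem_Iic.2 hi) hq

theorem le_of_mem_support_snakeGraph {s : List SnakeStep} {v : ℕ × ℕ}
    (hv : v ∈ (snakeGraph s).support) : v ≤ tileCorner s s.length + (1, 1) := by
  obtain ⟨e, he, hve⟩ := mem_support_iff_exists_mem_edgeSet.1 hv
  obtain ⟨i, hi, q, he⟩ := mem_edgeSet_snakeGraph.1 he
  have hcorner := tileCorner_mono s hi
  rw [Prod.le_def] at hcorner ⊢
  cases q <;> rcases he with rfl | rfl <;> rcases Sym2.mem_iff.1 hve with rfl | rfl <;>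
    simp only [SnakeStep.vec, SnakeStep.flip, Prod.fst_add, Prod.snd_add] <;> omega

theorem mem_edgeSet_snakeGraph_concat {s : List SnakeStep} {q : SnakeStep} {e : Sym2 (ℕ × ℕ)} :
    e ∈ (snakeGraph (s ++ [q])).edgeSet ↔ e ∈ (snakeGraph s).edgeSet ∨
      ∃ p, e = entrySide (s ++ [q]) (s.length + 1) p ∨
        e = exitSide (s ++ [q]) (s.length + 1) p := by
  have hold (i : ℕ) (hi : i ≤ s.length) (p : SnakeStep) :
      entrySide (s ++ [q]) i p = entrySide s i p ∧ exitSide (s ++ [q]) i p = exitSide s i p := by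
    simp only [entrySide, exitSide, tileCorner_append s [q] hi, and_self]
  simp only [mem_edgeSet_snakeGraph, List.length_append, List.length_singleton]
  constructor
  · rintro ⟨i, hi, p, he⟩
    rcases Nat.le_succ_iff.1 hi with hi | rfl
    · rw [(hold i hi p).1, (hold i hi p).2] at he
      exact Or.inl ⟨i, hi, p, he⟩
    · exact Or.inr ⟨p, he⟩
  · rintro (⟨i, hi, p, he⟩ | he)
    · rw [← (hold i hi p).1, ← (hold i hi p).2] at he
      exact ⟨i, by omega, p, he⟩
    · exact ⟨s.length + 1, le_rfl, he⟩

theorem SnakeStep.exists_iff (q : SnakeStep) {P : SnakeStep → Prop} :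
    (∃ p, P p) ↔ P q ∨ P q.flip := by
  constructor
  · rintro ⟨p, hp⟩
    by_cases hpq : p = q
    · exact Or.inl (hpq ▸ hp)
    · exact Or.inr (SnakeStep.eq_flip_of_ne hpq ▸ hp)
  · rintro (h | h)
    exacts [⟨q, h⟩, ⟨q.flip, h⟩]

theorem entrySide_concat (s : List SnakeStep) (q : SnakeStep) :
    entrySide (s ++ [q]) (s.length + 1) q = exitSide s s.length q := by
  rw [entrySide, exitSide, tileCorner_concat, add_assoc, SnakeStep.vec_add_vec_flip]

theorem entrySide_concat_flip (s : List SnakeStep) (q : SnakeStep) :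
    entrySide (s ++ [q]) (s.length + 1) q.flip =
      s(tileCorner s s.length + q.vec, tileCorner s s.length + q.vec + q.vec) := by
  rw [entrySide, tileCorner_concat, SnakeStep.flip_flip]

theorem exitSide_concat (s : List SnakeStep) (q : SnakeStep) :
    exitSide (s ++ [q]) (s.length + 1) q =
      s(tileCorner s s.length + q.vec + q.vec, tileCorner s s.length + q.vec + (1, 1)) := by
  rw [exitSide, tileCorner_concat]

theorem exitSide_concat_flip (s : List SnakeStep) (q : SnakeStep) :
    exitSide (s ++ [q]) (s.length + 1) q.flip =
      s(tileCorner s s.length + (1, 1), tileCorner s s.length + q.vec + (1, 1)) := by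
  rw [exitSide, tileCorner_concat, add_assoc, SnakeStep.vec_add_vec_flip]

theorem isSquareExtension_concat (s : List SnakeStep) (q : SnakeStep) :
    IsSquareExtension (snakeGraph s) (snakeGraph (s ++ [q]))
      (tileCorner s s.length + q.vec) (tileCorner s s.length + (1, 1))
      (tileCorner s s.length + q.vec + q.vec) (tileCorner s s.length + q.vec + (1, 1)) where
  adj := exitSide_mem_edgeSet s q
  left_notMem h := by
    have hle := le_of_mem_support_snakeGraph h
    cases q <;> simp [SnakeStep.vec, Prod.le_def] at hle
  right_notMem h := by
    have hle := le_of_mem_support_snakeGraph h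
    cases q <;> simp [SnakeStep.vec] at hle
  ne := by cases q <;> simp [SnakeStep.vec]
  mem_edgeSet e := by
    have hcommon : e = exitSide s s.length q → e ∈ (snakeGraph s).edgeSet := fun he =>
      he ▸ exitSide_mem_edgeSet s q
    rw [mem_edgeSet_snakeGraph_concat, SnakeStep.exists_iff q, entrySide_concat,
      entrySide_concat_flip, exitSide_concat, exitSide_concat_flip]
    tauto

theorem isSquareExtension_nil :
    IsSquareExtension (SimpleGraph.edge (0, 0) (0, 1)) (snakeGraph []) (0, 0) (0, 1) (1, 0)
      (1, 1) where
  adj := by simp [SimpleGraph.edge_adj]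
  left_notMem h := by
    obtain ⟨w, h⟩ := h
    simp [SimpleGraph.edge_adj] at h
  right_notMem h := by
    obtain ⟨w, h⟩ := h
    simp [SimpleGraph.edge_adj] at h
  ne := by simp
  mem_edgeSet e := by
    rw [SimpleGraph.edgeSet_edge_of_ne (by simp), Set.mem_singleton_iff, mem_edgeSet_snakeGraph]
    simp only [List.length_nil, Nat.le_zero, exists_eq_left, SnakeStep.exists_iff .right,
      SnakeStep.flip, entrySide, exitSide, SnakeStep.vec, tileCorner, List.take_nil,
      List.count_nil, Prod.mk_add_mk, zero_add]
    tauto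

/-- The side of the last tile whose multiplicity in a dimer cover is the label of that tile. -/
def labelSide (s : List SnakeStep) : Sym2 (ℕ × ℕ) :=
  exitSide s s.length (labelStep s.length)

theorem labelSide_mem_edgeSet (s : List SnakeStep) : labelSide s ∈ (snakeGraph s).edgeSet :=
  exitSide_mem_edgeSet s _

theorem ncard_count_exitSide_concat (s : List SnakeStep) (q : SnakeStep) {d j : ℕ}
    (hj : j ≤ d) :
    {D ∈ dimerCovers (snakeGraph (s ++ [q])) d |
        D.count (exitSide (s ++ [q]) (s.length + 1) q) = j}.ncard =
      {D ∈ dimerCovers (snakeGraph s) d | d - j ≤ D.count (exitSide s s.length q)}.ncard := by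
  rw [exitSide_concat]
  exact (isSquareExtension_concat s q).ncard_opposite hj

theorem ncard_count_exitSide_concat_flip (s : List SnakeStep) (q : SnakeStep) {d j : ℕ}
    (hj : j ≤ d) :
    {D ∈ dimerCovers (snakeGraph (s ++ [q])) d |
        D.count (exitSide (s ++ [q]) (s.length + 1) q.flip) = j}.ncard =
      {D ∈ dimerCovers (snakeGraph s) d | j ≤ D.count (exitSide s s.length q)}.ncard := by
  rw [exitSide_concat_flip]
  exact (isSquareExtension_concat s q).ncard_adjacent hj

theorem count_exitSide_add_count_exitSide_flip {s : List SnakeStep} {d : ℕ}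
    {D : Multiset (Sym2 (ℕ × ℕ))} (hD : D ∈ dimerCovers (snakeGraph s) d) (q : SnakeStep) :
    D.count (exitSide s s.length q) + D.count (exitSide s s.length q.flip) = d := by
  have hlast : ∃ p,
      D.count (exitSide s s.length p) + D.count (exitSide s s.length p.flip) = d := by
    induction s using List.reverseRecOn with
    | nil => exact ⟨.up, isSquareExtension_nil.count_add_count hD⟩
    | append_singleton s p =>
      rw [List.length_append, List.length_singleton]
      refine ⟨p, ?_⟩
      rw [exitSide_concat, exitSide_concat_flip, add_comm]
      exact (isSquareExtension_concat s p).count_add_count hD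
  obtain ⟨p, hp⟩ := hlast
  by_cases hqp : q = p
  · rw [hqp, hp]
  · rw [SnakeStep.eq_flip_of_ne hqp, SnakeStep.flip_flip, add_comm, hp]

theorem ncard_count_labelSide_concat (s : List SnakeStep) (q : SnakeStep) {d j : ℕ}
    (hj : j ≤ d) :
    {D ∈ dimerCovers (snakeGraph (s ++ [q])) d | D.count (labelSide (s ++ [q])) = j}.ncard =
      {D ∈ dimerCovers (snakeGraph s) d |
        if q ≠ labelStep s.length then D.count (labelSide s) ≤ j
        else j ≤ D.count (labelSide s)}.ncard := by
  simp only [labelSide, List.length_append, List.length_singleton, labelStep_succ]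
  by_cases hq : q = labelStep s.length
  · rw [← hq, ncard_count_exitSide_concat_flip s q hj]
    simp only [ne_eq, not_true_eq_false, if_false]
  · have hflip : (labelStep s.length).flip = q := (SnakeStep.eq_flip_of_ne hq).symm
    simp only [hflip, ne_eq, hq, not_false_eq_true, if_true]
    rw [ncard_count_exitSide_concat s q hj, ← hflip]
    congr 1
    ext D
    refine and_congr_right fun hD => ?_
    have := count_exitSide_add_count_exitSide_flip hD (labelStep s.length)
    omega

theorem ncard_sep_eq_sum_ncard_fiber {β : Type*} {A : Set β} (hA : A.Finite) {d : ℕ}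
    (c : β → ℕ) (hc : ∀ x ∈ A, c x ≤ d) (p : ℕ → Prop) [DecidablePred p] :
    {x ∈ A | p (c x)}.ncard =
      ∑ i : Fin (d + 1), if p i then {x ∈ A | c x = i}.ncard else 0 := by
  lift A to Finset β using hA
  have hncard (r : β → Prop) [DecidablePred r] :
      {x ∈ (A : Set β) | r x}.ncard = (A.filter r).card := by
    rw [← Set.ncard_coe_finset, Finset.coe_filter]
    rfl
  have hmaps : Set.MapsTo c (A.filter fun x => p (c x)) ((Finset.range (d + 1)).filter p) := by
    intro x hx
    simp only [Finset.coe_filter, Set.mem_ofPred_eq, Finset.mem_range, Nat.lt_succ_iff] at hx ⊢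
    exact ⟨hc x hx.1, hx.2⟩
  simp only [hncard]
  rw [Finset.card_eq_sum_card_fiberwise hmaps, Finset.sum_filter,
    Finset.sum_range fun i => if p i then _ else 0]
  refine Finset.sum_congr rfl fun i _ => if_ctx_congr Iff.rfl (fun hi => ?_) fun _ => rfl
  rw [Finset.filter_filter]
  congr 1
  refine Finset.filter_congr fun x _ => and_iff_right_of_imp fun hx => hx ▸ hi

theorem vecMul_arrowMatrix_apply {α : Type*} [LE α] [DecidableLE α] [Fintype α] (b : Bool)
    (v : α → ℕ) (j : α) :
    Matrix.vecMul v (arrowMatrix α b) j =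
      ∑ i, if (if b then i ≤ j else j ≤ i) then v i else 0 := by
  cases b <;> simp [Matrix.vecMul, dotProduct, arrowMatrix, zetaMatrix]

theorem ncard_count_labelSide_nil (d j : ℕ) (hj : j ≤ d) :
    {D ∈ dimerCovers (snakeGraph []) d | D.count (labelSide []) = j}.ncard = 1 := by
  refine (isSquareExtension_nil.ncard_adjacent hj).trans ?_
  rw [Set.ncard_eq_one, dimerCovers_edge (by simp)]
  refine ⟨Multiset.replicate d s((0, 0), (0, 1)), Set.sep_eq_self_iff_mem_true.2 ?_⟩
  rintro _ rfl
  rwa [Multiset.count_replicate_self]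

theorem ncard_count_labelSide (s : List SnakeStep) (d : ℕ) (j : Fin (d + 1)) :
    {D ∈ dimerCovers (snakeGraph s) d | D.count (labelSide s) = j}.ncard =
      Matrix.vecMul 1 (stringMatrix (Fin (d + 1)) (abstractString s)) j := by
  induction s using List.reverseRecOn generalizing j with
  | nil =>
    rw [ncard_count_labelSide_nil d j j.is_le]
    simp [stringMatrix, abstractString]
  | append_singleton s q ih =>
    rw [abstractString_concat, stringMatrix, List.map_append, List.prod_append,
      ← Matrix.vecMul_vecMul, List.map_singleton, List.prod_singleton, vecMul_arrowMatrix_apply,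
      ncard_count_labelSide_concat s q j.is_le,
      ncard_sep_eq_sum_ncard_fiber (finite_dimerCovers (finite_edgeSet_snakeGraph s) d)
        (fun D => D.count (labelSide s))
        (fun D hD => count_le_of_mem_dimerCovers hD (labelSide_mem_edgeSet s))
        (fun i => if q ≠ labelStep s.length then i ≤ j else j ≤ i)]
    simp only [ih, decide_eq_true_eq, Fin.le_def]
    rfl

theorem ncard_dimerCovers_snakeGraph (s : List SnakeStep) (d : ℕ) :
    (dimerCovers (snakeGraph s) d).ncard =
      (monotoneLabelings (Fin (d + 1)) (abstractString s)).ncard := by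
  have hsum := ncard_sep_eq_sum_ncard_fiber (finite_dimerCovers (finite_edgeSet_snakeGraph s) d)
    (fun D => D.count (labelSide s))
    (fun D hD => count_le_of_mem_dimerCovers hD (labelSide_mem_edgeSet s)) fun _ => True
  simp only [and_true, if_true, Set.ofPred_mem_eq, ncard_count_labelSide] at hsum
  rw [hsum, ncard_monotoneLabelings]
  simp only [Matrix.vecMul, dotProduct, Pi.one_apply, one_mul]
  exact Finset.sum_comm

/-! ### Truncated polynomials -/

namespace TruncPoly

variable {K : Type*} [Field K] {d : ℕ}

theorem exists_ideal_eq_span_eps_pow (J : Ideal (TruncPoly K d)) :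
    ∃ k ≤ d, J = Ideal.span {eps K d ^ k} := by
  obtain ⟨g, hg⟩ := IsPrincipalIdealRing.principal
    (J.comap (Ideal.Quotient.mk (Ideal.span {(Polynomial.X : Polynomial K) ^ d})))
  have hX : (Polynomial.X : Polynomial K) ^ d ∈
      J.comap (Ideal.Quotient.mk (Ideal.span {(Polynomial.X : Polynomial K) ^ d})) := by
    rw [Ideal.mem_comap, Ideal.Quotient.eq_zero_iff_mem.2 (Ideal.mem_span_singleton_self _)]
    exact J.zero_mem
  rw [hg] at hX
  obtain ⟨k, hk, hgk⟩ := (dvd_prime_pow Polynomial.prime_X d).1 (Ideal.mem_span_singleton.1 hX)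
  refine ⟨k, hk, ?_⟩
  rw [← Ideal.map_comap_of_surjective _ Ideal.Quotient.mk_surjective J, hg, ← Ideal.span,
    Ideal.span_singleton_eq_span_singleton.2 hgk, Ideal.map_span, Set.image_singleton, map_pow]
  rfl

theorem eps_pow_dvd_eps_pow_iff {k l : ℕ} (hk : k < d) :
    eps K d ^ l ∣ eps K d ^ k ↔ l ≤ k := by
  refine ⟨fun ⟨q, hq⟩ => ?_, pow_dvd_pow _⟩
  obtain ⟨q, rfl⟩ := Ideal.Quotient.mk_surjective q
  rw [eps, ← map_pow, ← map_pow, ← map_mul, Ideal.Quotient.eq, Ideal.mem_span_singleton] at hq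
  by_contra! hl
  have hdvd : (Polynomial.X : Polynomial K) ^ (k + 1) ∣ Polynomial.X ^ k :=
    (dvd_sub_left ((pow_dvd_pow _ hl).mul_right q)).1 ((pow_dvd_pow _ hk).trans hq)
  exact absurd ((pow_dvd_pow_iff Polynomial.X_ne_zero Polynomial.not_isUnit_X).1 hdvd) (by omega)

theorem span_eps_pow_le_span_eps_pow_iff {k l : ℕ} (hk : k ≤ d) (hl : l ≤ d) :
    Ideal.span {eps K d ^ k} ≤ Ideal.span {eps K d ^ l} ↔ l ≤ k := by
  rw [Ideal.span_singleton_le_span_singleton]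
  rcases hk.lt_or_eq with hk | rfl
  · exact eps_pow_dvd_eps_pow_iff hk
  · exact iff_of_true (pow_dvd_pow _ hl) hl

variable (K d) in
/-- The ideals of `K[ε]/(ε^d)` form the chain `(ε^d) ≤ … ≤ (ε) ≤ (1)`. -/
noncomputable def idealOrderIso : Fin (d + 1) ≃o Ideal (TruncPoly K d) :=
  RelIso.ofSurjective
    (OrderEmbedding.ofMapLEIff (fun i : Fin (d + 1) => Ideal.span {eps K d ^ (d - i : ℕ)})
      fun i j => by
        rw [span_eps_pow_le_span_eps_pow_iff (Nat.sub_le d i) (Nat.sub_le d j), Fin.le_def]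
        omega)
    fun J => by
      obtain ⟨k, hk, rfl⟩ := exists_ideal_eq_span_eps_pow J
      refine ⟨⟨d - k, by omega⟩, ?_⟩
      simp only [OrderEmbedding.coe_ofMapLEIff, Nat.sub_sub_self hk]

@[elab_as_elim]
theorem induction {motive : TruncPoly K d → Prop} (q : TruncPoly K d)
    (add : ∀ p q, motive p → motive q → motive (p + q))
    (smul_eps_pow : ∀ (c : K) (k : ℕ), motive (c • eps K d ^ k)) : motive q := by
  obtain ⟨q, rfl⟩ := Ideal.Quotient.mk_surjective q
  induction q using Polynomial.induction_on' with
  | add p q hp hq => rw [map_add]; exact add _ _ hp hq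
  | monomial n a =>
    rw [← Polynomial.C_mul_X_pow_eq_monomial, ← Polynomial.smul_eq_C_mul]
    exact smul_eps_pow a n

end TruncPoly

/-! ### Canonical submodules of induced modules -/

namespace InducedModule

variable {K : Type*} [Field K] {Λ : Type*} [Ring Λ] [Algebra K Λ] {M : Type*}
    [AddCommGroup M] [Module K M] [Module Λ M] [IsScalarTower K Λ M] {d : ℕ}

instance : IsScalarTower K (Λ ⊗[K] TruncPoly K d) (InducedModule K Λ M d) where
  smul_assoc c r m := by
    change action K Λ M d (c • r) m = c • action K Λ M d r m
    rw [map_smul, LinearMap.smul_apply]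

@[elab_as_elim]
theorem induction {motive : InducedModule K Λ M d → Prop} (x : InducedModule K Λ M d)
    (zero : motive 0) (tmul : ∀ m p, motive (tmul K Λ M d m p))
    (add : ∀ x y, motive x → motive y → motive (x + y)) : motive x :=
  TensorProduct.induction_on (motive := motive) x zero tmul add

theorem smul_mem_of_tmul_smul_mem (P : Submodule K (InducedModule K Λ M d))
    {m : InducedModule K Λ M d}
    (hm : ∀ (x : Λ) (q : TruncPoly K d), (x ⊗ₜ[K] q : Λ ⊗[K] TruncPoly K d) • m ∈ P)
    (r : Λ ⊗[K] TruncPoly K d) : r • m ∈ P := by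
  change action K Λ M d r m ∈ P
  induction r using TensorProduct.induction_on with
  | zero => rw [map_zero]; exact P.zero_mem
  | tmul x q => exact hm x q
  | add r r' hr hr' => rw [map_add]; exact P.add_mem hr hr'

/-- The linear map `p ↦ m ⊗ p`. -/
noncomputable def tmulHom (m : M) : TruncPoly K d →ₗ[K] InducedModule K Λ M d :=
  TensorProduct.mk K M (TruncPoly K d) m

theorem tmulHom_apply (m : M) (p : TruncPoly K d) :
    tmulHom (Λ := Λ) m p = tmul K Λ M d m p := rfl

/-- The ideal of the truncated polynomials `p` with `m ⊗ p` in a given submodule. -/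
def component (N : Submodule (Λ ⊗[K] TruncPoly K d) (InducedModule K Λ M d)) (m : M) :
    Ideal (TruncPoly K d) where
  carrier := {p | tmul K Λ M d m p ∈ N}
  add_mem' hp hq := by
    simp only [Set.mem_ofPred_eq, ← tmulHom_apply, map_add] at hp hq ⊢
    exact N.add_mem hp hq
  zero_mem' := by
    simp only [Set.mem_ofPred_eq, ← tmulHom_apply, map_zero]
    exact N.zero_mem
  smul_mem' q p hp := by
    have hqp := N.smul_mem (1 ⊗ₜ[K] q) hp
    rwa [smul_tmul, one_smul] at hqp

theorem mem_component {N : Submodule (Λ ⊗[K] TruncPoly K d) (InducedModule K Λ M d)} {m : M}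
    {p : TruncPoly K d} : p ∈ component N m ↔ tmul K Λ M d m p ∈ N := Iff.rfl

variable {ι : Type*} (b : Module.Basis ι K M)

open Classical in
/-- The coefficients in `K[ε]/(ε^d)` of an element of the induced module with respect to a basis
of `M`. -/
noncomputable def coords : InducedModule K Λ M d ≃ₗ[K] ι →₀ TruncPoly K d :=
  TensorProduct.equivFinsuppOfBasisLeft b

theorem coords_tmul (m : M) (p : TruncPoly K d) (i : ι) :
    coords b (tmul K Λ M d m p) i = b.repr m i • p := by
  classical exact TensorProduct.equivFinsuppOfBasisLeft_apply_tmul_apply b m p i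

theorem coords_tmul_basis (i : ι) (p : TruncPoly K d) :
    coords b (tmul K Λ M d (b i) p) = Finsupp.single i p := by
  classical
  ext j
  simp only [coords_tmul, b.repr_self, Finsupp.single_apply, ite_smul, one_smul, zero_smul]

theorem sum_tmul_coords (m : InducedModule K Λ M d) :
    ((coords b m).sum fun i p => tmul K Λ M d (b i) p) = m := by
  classical
  have hsymm := TensorProduct.equivFinsuppOfBasisLeft_symm_apply b (coords b m)
  exact hsymm.symm.trans ((coords b).symm_apply_apply m)

theorem coords_smul (x : Λ) (q : TruncPoly K d) (m : InducedModule K Λ M d) (j : ι) :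
    coords b ((x ⊗ₜ[K] q : Λ ⊗[K] TruncPoly K d) • m) j =
      (coords b m).sum fun i p => b.repr (x • b i) j • (q * p) := by
  conv_lhs => rw [← sum_tmul_coords b m, Finsupp.sum, Finset.smul_sum, map_sum,
    Finsupp.finsetSum_apply]
  simp only [smul_tmul, coords_tmul]
  rfl

theorem tmul_smul_eq_tmul_coords {x : Λ} {i : ι} (hx : ∀ m : M, x • m = b.repr m i • b i)
    (m : InducedModule K Λ M d) :
    (x ⊗ₜ[K] 1 : Λ ⊗[K] TruncPoly K d) • m = tmul K Λ M d (b i) (coords b m i) := by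
  induction m using InducedModule.induction with
  | zero => simp only [smul_zero, map_zero, Finsupp.coe_zero, Pi.zero_apply, ← tmulHom_apply]
  | tmul m p =>
    rw [smul_tmul, hx, one_mul, coords_tmul]
    exact TensorProduct.smul_tmul _ _ _
  | add m m' hm hm' =>
    simp only [smul_add, hm, hm', map_add, Finsupp.coe_add, Pi.add_apply, ← tmulHom_apply]

/-- The subspace `⨁ i, b i ⊗ J i` attached to a family of ideals of `K[ε]/(ε^d)`. -/
noncomputable def ofIdeals (J : ι → Ideal (TruncPoly K d)) :
    Submodule K (InducedModule K Λ M d) :=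
  ⨅ i, ((J i).restrictScalars K).comap (Finsupp.lapply i ∘ₗ (coords b).toLinearMap)

theorem mem_ofIdeals {J : ι → Ideal (TruncPoly K d)} {m : InducedModule K Λ M d} :
    m ∈ ofIdeals b J ↔ ∀ i, coords b m i ∈ J i := by
  simp only [ofIdeals, Submodule.mem_iInf, Submodule.mem_comap, Submodule.restrictScalars_mem,
    LinearMap.comp_apply, LinearEquiv.coe_coe, Finsupp.lapply_apply]

theorem tmul_basis_mem_ofIdeals {J : ι → Ideal (TruncPoly K d)} {i : ι} {p : TruncPoly K d} :
    tmul K Λ M d (b i) p ∈ ofIdeals b J ↔ p ∈ J i := by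
  classical
  simp only [mem_ofIdeals, coords_tmul_basis, Finsupp.single_apply]
  refine ⟨fun h => by simpa only [if_true] using h i, fun hp j => ?_⟩
  split_ifs with hij
  · exact hij ▸ hp
  · exact (J j).zero_mem

/-- A labeling of a basis of `M` is stable if labels increase weakly along the nonzero matrix
entries of the action of `Λ`. -/
def IsStable (Λ : Type*) [SMul Λ M] {α : Type*} [LE α] (J : ι → α) : Prop :=
  ∀ (x : Λ) (i j : ι), b.repr (x • b i) j ≠ 0 → J i ≤ J j

/-- The canonical submodules with respect to a basis of `M`: those spanned by some of the vectors
`b i ⊗ ε^k`. -/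
def IsCanonical (N : Submodule (Λ ⊗[K] TruncPoly K d) (InducedModule K Λ M d)) : Prop :=
  ∃ S : Set (ι × ℕ), (N : Set (InducedModule K Λ M d)) = Submodule.span K
    ((fun p => tmul K Λ M d (b p.1) (TruncPoly.eps K d ^ p.2)) '' S)

theorem smul_mem_ofIdeals {J : ι → Ideal (TruncPoly K d)} (hJ : IsStable b Λ J)
    (r : Λ ⊗[K] TruncPoly K d) {m : InducedModule K Λ M d} (hm : m ∈ ofIdeals b J) :
    r • m ∈ ofIdeals b J := by
  refine smul_mem_of_tmul_smul_mem _ (fun x q => (mem_ofIdeals b).2 fun j => ?_) r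
  rw [coords_smul]
  refine Ideal.sum_mem _ fun i _ => ?_
  beta_reduce
  by_cases hx : b.repr (x • b i) j = 0
  · rw [hx, zero_smul]
    exact (J j).zero_mem
  · exact Submodule.smul_of_tower_mem _ _
      (Ideal.mul_mem_left _ q (hJ x i j hx ((mem_ofIdeals b).1 hm i)))

theorem ofIdeals_eq_span (J : ι → Ideal (TruncPoly K d)) :
    ofIdeals b J = Submodule.span K
      ((fun p : ι × ℕ => tmul K Λ M d (b p.1) (TruncPoly.eps K d ^ p.2)) ''
        {p | TruncPoly.eps K d ^ p.2 ∈ J p.1}) := by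
  refine le_antisymm (fun m hm => ?_) (Submodule.span_le.2 ?_)
  · rw [← sum_tmul_coords b m]
    refine Submodule.sum_mem _ fun i _ => ?_
    beta_reduce
    have hi := (mem_ofIdeals b).1 hm i
    obtain ⟨k, -, hk⟩ := TruncPoly.exists_ideal_eq_span_eps_pow (J i)
    rw [hk] at hi
    obtain ⟨q, hq⟩ := Ideal.mem_span_singleton'.1 hi
    rw [← hq, ← tmulHom_apply]
    clear hq
    induction q using TruncPoly.induction with
    | add p q hp hq => rw [add_mul, map_add]; exact Submodule.add_mem _ hp hq
    | smul_eps_pow c l =>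
      rw [smul_mul_assoc, map_smul, ← pow_add]
      refine Submodule.smul_mem _ _ (Submodule.subset_span ⟨(i, l + k), ?_, rfl⟩)
      rw [Set.mem_ofPred_eq, hk]
      exact Ideal.mem_span_singleton.2 (pow_dvd_pow _ (Nat.le_add_left k l))
  · rintro _ ⟨p, hp, rfl⟩
    exact (tmul_basis_mem_ofIdeals b).2 hp

variable {b} {N : Submodule (Λ ⊗[K] TruncPoly K d) (InducedModule K Λ M d)}

theorem IsCanonical.coords_mem_component (hN : IsCanonical b N) {m : InducedModule K Λ M d}
    (hm : m ∈ N) (i : ι) : coords b m i ∈ component N (b i) := by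
  obtain ⟨S, hS⟩ := hN
  have hle : Submodule.span K
      ((fun p => tmul K Λ M d (b p.1) (TruncPoly.eps K d ^ p.2)) '' S) ≤
        ofIdeals b fun i => component N (b i) := by
    refine Submodule.span_le.2 ?_
    rintro _ ⟨p, hp, rfl⟩
    refine (tmul_basis_mem_ofIdeals b).2 (mem_component.2 (SetLike.mem_coe.1 ?_))
    rw [hS]
    exact Submodule.subset_span ⟨p, hp, rfl⟩
  rw [← SetLike.mem_coe, hS] at hm
  exact (mem_ofIdeals b).1 (hle hm) i

theorem IsCanonical.isStable_component (hN : IsCanonical b N) :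
    IsStable b Λ fun i => component N (b i) := by
  intro x i j hx p hp
  have hmem := N.smul_mem (x ⊗ₜ[K] 1) hp
  rw [smul_tmul, one_mul] at hmem
  have hcoords := hN.coords_mem_component hmem j
  rw [coords_tmul] at hcoords
  exact (Submodule.smul_mem_iff ((component N (b j)).restrictScalars K) hx).1 hcoords

theorem mem_of_coords_mem_component {m : InducedModule K Λ M d}
    (hm : ∀ i, coords b m i ∈ component N (b i)) : m ∈ N := by
  rw [← sum_tmul_coords b m]
  exact N.sum_mem fun i _ => mem_component.1 (hm i)

theorem isCanonical_of_coords_mem_component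
    (hN : ∀ m ∈ N, ∀ i, coords b m i ∈ component N (b i)) : IsCanonical b N := by
  refine ⟨{p | TruncPoly.eps K d ^ p.2 ∈ component N (b p.1)}, ?_⟩
  rw [← ofIdeals_eq_span b fun i => component N (b i)]
  ext m
  exact ⟨fun hm => (mem_ofIdeals b).2 (hN m hm), fun hm =>
    mem_of_coords_mem_component ((mem_ofIdeals b).1 hm)⟩

theorem isCanonical_of_exists_smul_eq
    (hb : ∀ i, ∃ x : Λ, ∀ m : M, x • m = b.repr m i • b i)
    (N : Submodule (Λ ⊗[K] TruncPoly K d) (InducedModule K Λ M d)) : IsCanonical b N := by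
  refine isCanonical_of_coords_mem_component fun m hm i => ?_
  obtain ⟨x, hx⟩ := hb i
  rw [mem_component, ← tmul_smul_eq_tmul_coords b hx]
  exact N.smul_mem _ hm

variable (b Λ d) in
/-- A canonical submodule is determined by its components, which form a stable family. -/
noncomputable def stableEquivCanonical :
    {J : ι → Ideal (TruncPoly K d) // IsStable b Λ J} ≃
      {N : Submodule (Λ ⊗[K] TruncPoly K d) (InducedModule K Λ M d) // IsCanonical b N} where
  toFun J :=
    ⟨{ ofIdeals b J.1 with smul_mem' := fun r _ hm => smul_mem_ofIdeals b J.2 r hm },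
      _, congrArg SetLike.coe (ofIdeals_eq_span b J.1)⟩
  invFun N := ⟨fun i => component N.1 (b i), N.2.isStable_component⟩
  left_inv _ := Subtype.ext <| funext fun _ => Ideal.ext fun _ => tmul_basis_mem_ofIdeals b
  right_inv N := Subtype.ext <| Submodule.ext fun _ => (mem_ofIdeals b).trans
    ⟨mem_of_coords_mem_component, N.2.coords_mem_component⟩

end InducedModule

/-! ### String modules -/

namespace PathAlgebra

variable (K : Type*) [Field K] {V : Type*} [Fintype V] [Quiver V]

/-- The idempotent `e_v` of the path algebra at a vertex `v`. -/
def idempotent (v : V) : PathAlgebra K V :=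
  RingQuot.mkAlgHom K (PathRel K V) (FreeAlgebra.ι K (Sum.inl v))

/-- An arrow of the quiver as an element of the path algebra. -/
def arrow (a : Quiver.Total V) : PathAlgebra K V :=
  RingQuot.mkAlgHom K (PathRel K V) (FreeAlgebra.ι K (Sum.inr a))

variable {K} in
@[elab_as_elim]
theorem induction {motive : PathAlgebra K V → Prop} (x : PathAlgebra K V)
    (algebraMap : ∀ c : K, motive (algebraMap K (PathAlgebra K V) c))
    (idempotent : ∀ v, motive (idempotent K v)) (arrow : ∀ a, motive (arrow K a))
    (mul : ∀ x y, motive x → motive y → motive (x * y))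
    (add : ∀ x y, motive x → motive y → motive (x + y)) : motive x := by
  obtain ⟨x, rfl⟩ := RingQuot.mkAlgHom_surjective K (PathRel K V) x
  induction x using FreeAlgebra.induction with
  | grade0 c => rw [AlgHom.commutes]; exact algebraMap c
  | grade1 g => exact g.casesOn idempotent arrow
  | mul x y hx hy => rw [map_mul]; exact mul _ _ hx hy
  | add x y hx hy => rw [map_add]; exact add _ _ hx hy

end PathAlgebra

namespace QuiverString

variable {K : Type*} [Field K] {V : Type*} [Quiver V] {u : List Bool} (w : QuiverString V u)

theorem eq_of_tailIndex_eq {i j : Fin u.length} (h : w.letter i = w.letter j)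
    (ht : tailIndex u i = tailIndex u j) : i = j := by
  by_contra hij
  have hne : (i : ℕ) ≠ j := fun h => hij (Fin.ext h)
  simp only [tailIndex] at ht
  split_ifs at ht with hi hj hj <;> simp only [Fin.ext_iff, Fin.val_castSucc, Fin.val_succ] at ht
  · exact hne ht
  · exact w.reduced j i ht (fun hji => hj (hji ▸ hi)) h.symm
  · exact w.reduced i j ht.symm (fun hij => hi (hij ▸ hj)) h
  · omega

theorem arrowMap_letter_single_tailIndex (i : Fin u.length) :
    w.arrowMap K (w.letter i) (Pi.single (tailIndex u i) 1) = Pi.single (headIndex u i) 1 := by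
  classical
  funext j
  rw [arrowMap_apply, Finset.sum_eq_single i]
  · simp only [true_and, Pi.single_eq_same, Pi.single_apply, eq_comm]
  · intro k _ hk
    refine ite_eq_right_iff.2 fun h => ?_
    exact Pi.single_eq_of_ne (fun ht => hk (w.eq_of_tailIndex_eq h.1 ht)) _
  · exact fun hi => absurd (Finset.mem_univ i) hi

theorem vertexMap_of_injective (hw : Function.Injective w.vertex) (i : Fin (u.length + 1))
    (x : Fin (u.length + 1) → K) : w.vertexMap K (w.vertex i) x = Pi.single i (x i) := by
  funext j
  simp only [vertexMap_apply, Pi.single_apply, hw.eq_iff]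
  split_ifs with h
  · rw [h]
  · rfl

variable [Fintype V]

theorem pathAction_idempotent (v : V) :
    w.pathAction K (PathAlgebra.idempotent K v) = w.vertexMap K v := by
  rw [pathAction, PathAlgebra.idempotent, RingQuot.liftAlgHom_mkAlgHom_apply,
    FreeAlgebra.lift_ι_apply, Sum.elim_inl]

theorem pathAction_arrow (a : Quiver.Total V) :
    w.pathAction K (PathAlgebra.arrow K a) = w.arrowMap K a := by
  rw [pathAction, PathAlgebra.arrow, RingQuot.liftAlgHom_mkAlgHom_apply,
    FreeAlgebra.lift_ι_apply, Sum.elim_inr]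

theorem pathAction_mem {P : Submodule K (Fin (u.length + 1) → K)}
    (hvertex : ∀ v, ∀ m ∈ P, w.vertexMap K v m ∈ P)
    (harrow : ∀ a, ∀ m ∈ P, w.arrowMap K a m ∈ P) (x : PathAlgebra K V)
    {m : Fin (u.length + 1) → K} (hm : m ∈ P) : w.pathAction K x m ∈ P := by
  induction x using PathAlgebra.induction generalizing m with
  | algebraMap c => rw [AlgHom.commutes]; exact P.smul_mem c hm
  | idempotent v => rw [pathAction_idempotent]; exact hvertex v m hm
  | arrow a => rw [pathAction_arrow]; exact harrow a m hm
  | mul x y hx hy => rw [map_mul]; exact hx (hy hm)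
  | add x y hx hy => rw [map_add]; exact P.add_mem (hx hm) (hy hm)

theorem le_of_pathAction_single_ne_zero {α : Type*} [Preorder α]
    {h : Fin (u.length + 1) → α} (hh : h ∈ monotoneLabelings α u) {x : PathAlgebra K V}
    {i j : Fin (u.length + 1)} (hx : w.pathAction K x (Pi.single i 1) j ≠ 0) : h i ≤ h j := by
  classical
  let P : Submodule K (Fin (u.length + 1) → K) := Submodule.pi {k | ¬h i ≤ h k} fun _ => ⊥
  have hP (m : Fin (u.length + 1) → K) : m ∈ P ↔ ∀ k, ¬h i ≤ h k → m k = 0 := by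
    simp only [P, Submodule.mem_pi, Set.mem_ofPred_eq, Submodule.mem_bot]
  have hvertex (v : V) (m) (hm : m ∈ P) : w.vertexMap K v m ∈ P := (hP _).2 fun k hk => by
    rw [vertexMap_apply, (hP m).1 hm k hk, ite_self]
  have harrow (a : Quiver.Total V) (m) (hm : m ∈ P) : w.arrowMap K a m ∈ P :=
    (hP _).2 fun k hk => by
      rw [arrowMap_apply]
      refine Finset.sum_eq_zero fun l _ => ite_eq_right_iff.2 fun ⟨_, hl⟩ => ?_
      exact (hP m).1 hm _ fun hil => hk (hl ▸ hil.trans (hh l))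
  have hi : Pi.single i 1 ∈ P := (hP _).2 fun k hk =>
    Pi.single_eq_of_ne (fun hki : k = i => hk (hki ▸ le_rfl)) _
  by_contra hij
  exact hx ((hP _).1 (w.pathAction_mem hvertex harrow x hi) j hij)

end QuiverString

namespace StringModule

variable {K : Type*} [Field K] {V : Type*} [Quiver V] [Fintype V] {u : List Bool}
  (w : QuiverString V u) (I : Ideal (PathAlgebra K V)) (hI : w.IsAnnihilatedBy K I)

/-- The standard basis of a string module. -/
noncomputable def basis : Module.Basis (Fin (u.length + 1)) K (StringModule w I hI) :=
  Pi.basisFun K (Fin (u.length + 1))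

theorem basis_apply (i : Fin (u.length + 1)) : basis w I hI i = basisVec w I hI i :=
  Pi.basisFun_apply K _ i

variable [I.IsTwoSided]

theorem repr_mk_smul_basis (x : PathAlgebra K V) (i j : Fin (u.length + 1)) :
    (basis w I hI).repr (Ideal.Quotient.mk I x • basis w I hI i) j =
      w.pathAction K x (Pi.single i 1) j := by
  rw [basis_apply]
  rfl

theorem mk_arrow_smul_basis (i : Fin u.length) :
    Ideal.Quotient.mk I (PathAlgebra.arrow K (w.letter i)) • basis w I hI (tailIndex u i) =
      basis w I hI (headIndex u i) := by
  rw [basis_apply, basis_apply]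
  change w.pathAction K _ (Pi.single (tailIndex u i) 1) = Pi.single (headIndex u i) 1
  rw [w.pathAction_arrow, w.arrowMap_letter_single_tailIndex]

theorem mk_idempotent_smul (hw : Function.Injective w.vertex) (i : Fin (u.length + 1))
    (m : StringModule w I hI) :
    Ideal.Quotient.mk I (PathAlgebra.idempotent K (w.vertex i)) • m =
      (basis w I hI).repr m i • basis w I hI i := by
  have hx (x : Fin (u.length + 1) → K) :
      w.pathAction K (PathAlgebra.idempotent K (w.vertex i)) x = x i • Pi.single i 1 := by
    rw [w.pathAction_idempotent, w.vertexMap_of_injective hw, ← Pi.single_smul, smul_eq_mul,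
      mul_one]
  rw [basis_apply]
  exact hx m

theorem isStable_basis_iff {α : Type*} [Preorder α] {J : Fin (u.length + 1) → α} :
    InducedModule.IsStable (basis w I hI) (PathAlgebra K V ⧸ I) J ↔
      J ∈ monotoneLabelings α u := by
  refine ⟨fun hJ i => hJ (Ideal.Quotient.mk I (PathAlgebra.arrow K (w.letter i))) _ _ ?_,
    fun hJ x i j hx => ?_⟩
  · rw [mk_arrow_smul_basis, Module.Basis.repr_self, Finsupp.single_eq_same]
    exact one_ne_zero
  · obtain ⟨x, rfl⟩ := Ideal.Quotient.mk_surjective x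
    rw [repr_mk_smul_basis] at hx
    exact w.le_of_pathAction_single_ne_zero hJ hx

end StringModule

/-- An isomorphism of the ordered sets of labels carries monotone labelings to monotone
labelings. -/
def monotoneLabelingsCongr {α β : Type*} [LE α] [LE β] (e : α ≃o β) (u : List Bool) :
    monotoneLabelings α u ≃ monotoneLabelings β u :=
  (Equiv.arrowCongr (Equiv.refl _) e.toEquiv).subtypeEquiv fun _ =>
    forall_congr' fun _ => e.le_iff_le.symm

namespace InducedStringModule

variable {K : Type*} [Field K] {V : Type*} [Quiver V] [Fintype V] {u : List Bool}
  (w : QuiverString V u) (I : Ideal (PathAlgebra K V)) [I.IsTwoSided]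
  (hI : w.IsAnnihilatedBy K I) (d : ℕ)

theorem isCanonical_basis_iff {N : InducedStringSubmodule w I hI d} :
    InducedModule.IsCanonical (StringModule.basis w I hI) N ↔
      N ∈ canonicalSubmodules w I hI d := by
  simp only [InducedModule.IsCanonical, StringModule.basis_apply]
  rfl

/-- The canonical submodule attached to a labeling has the ideal `(ε^(d - k))` at a vertex of the
string with label `k`. -/
noncomputable def labelingEquivCanonical :
    monotoneLabelings (Fin (d + 1)) u ≃ canonicalSubmodules w I hI d :=
  calc ↥(monotoneLabelings (Fin (d + 1)) u)
    _ ≃ ↥(monotoneLabelings (Ideal (TruncPoly K d)) u) :=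
      monotoneLabelingsCongr (TruncPoly.idealOrderIso K d) u
    _ ≃ {J // InducedModule.IsStable (StringModule.basis w I hI) (PathAlgebra K V ⧸ I) J} :=
      Equiv.subtypeEquivRight fun _ => (StringModule.isStable_basis_iff w I hI).symm
    _ ≃ {N // InducedModule.IsCanonical (StringModule.basis w I hI) N} :=
      InducedModule.stableEquivCanonical (PathAlgebra K V ⧸ I) d (StringModule.basis w I hI)
    _ ≃ ↥(canonicalSubmodules w I hI d) :=
      Equiv.subtypeEquivRight fun _ => isCanonical_basis_iff w I hI d

theorem finite_canonicalSubmodules : (canonicalSubmodules w I hI d).Finite :=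
  Set.finite_coe_iff.1 (Finite.of_equiv _ (labelingEquivCanonical w I hI d))

theorem ncard_canonicalSubmodules :
    (canonicalSubmodules w I hI d).ncard = (monotoneLabelings (Fin (d + 1)) u).ncard :=
  (Set.ncard_congr' (labelingEquivCanonical w I hI d)).symm

theorem canonicalSubmodules_eq_univ (hw : Function.Injective w.vertex) :
    canonicalSubmodules w I hI d = Set.univ :=
  Set.eq_univ_of_forall fun N => (isCanonical_basis_iff w I hI d).1 <|
    InducedModule.isCanonical_of_exists_smul_eq
      (fun i => ⟨_, StringModule.mk_idempotent_smul w I hI hw i⟩) N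

end InducedStringModule

theorem mainTheorem5 {K : Type*} [Field K] {V : Type*} [Fintype V] [Quiver V]
    (s : List SnakeStep) (w : QuiverString V (abstractString s))
    (I : Ideal (PathAlgebra K V)) [I.IsTwoSided] (hI : w.IsAnnihilatedBy K I) (d : ℕ) :
    -- the number of `d`-dimer covers is the number of canonical submodules
    ((dimerCovers (snakeGraph s) d).Finite ∧ (canonicalSubmodules w I hI d).Finite ∧
      (dimerCovers (snakeGraph s) d).ncard = (canonicalSubmodules w I hI d).ncard) ∧
    -- it is the number of all submodules if the string does not repeat a vertex
    (Function.Injective w.vertex →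
      canonicalSubmodules w I hI d = Set.univ ∧ Finite (InducedStringSubmodule w I hI d) ∧
        (dimerCovers (snakeGraph s) d).ncard = Nat.card (InducedStringSubmodule w I hI d)) ∧
    -- matrix product and higher continued fraction
    ∀ a : List ℕ, IsSnakeGraphOfCF s a →
      (canonicalSubmodules w I hI d).ncard = (a.map (multichooseMatrix d)).prod 0 0 ∧
      (canonicalSubmodules w I hI d).ncard = higherCFNum d a d ∧
      0 < higherCFDen d a ∧
      (∀ s' : List SnakeStep, IsSnakeGraphOfCF s' a.tail →
        higherCFDen d a = (dimerCovers (snakeGraph s') d).ncard) ∧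
      ∀ i ≤ d, higherCF d a i = (higherCFNum d a i : ℚ) / (higherCFDen d a : ℚ) := by
  have hcount : (dimerCovers (snakeGraph s) d).ncard = (canonicalSubmodules w I hI d).ncard := by
    rw [ncard_dimerCovers_snakeGraph, InducedStringModule.ncard_canonicalSubmodules]
  have hfin := InducedStringModule.finite_canonicalSubmodules w I hI d
  refine ⟨⟨finite_dimerCovers (finite_edgeSet_snakeGraph s) d, hfin, hcount⟩,
    fun hw => ?_, fun a ha => ?_⟩
  · have huniv := InducedStringModule.canonicalSubmodules_eq_univ w I hI d hw
    rw [huniv] at hfin hcount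
    exact ⟨huniv, Set.finite_univ_iff.1 hfin, hcount.trans (Set.ncard_univ _)⟩
  · have hprod : (canonicalSubmodules w I hI d).ncard = (a.map (multichooseMatrix d)).prod 0 0 := by
      rw [InducedStringModule.ncard_canonicalSubmodules, ha.ncard_monotoneLabelings]
    have hden (s' : List SnakeStep) (hs' : IsSnakeGraphOfCF s' a.tail) :
        higherCFDen d a = (dimerCovers (snakeGraph s') d).ncard := by
      rw [ncard_dimerCovers_snakeGraph, hs'.ncard_monotoneLabelings,
        higherCFDen_eq_higherCFNum_tail d hs'.ne_nil]
      exact (prod_multichooseMatrix_apply_zero d hs'.ne_nil 0).symm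
    exact ⟨hprod, hprod.trans (prod_multichooseMatrix_apply_zero d ha.ne_nil 0),
      higherCFDen_pos d ha.1, hden, fun i _ => higherCF_eq_num_div_den d ha.1 i⟩
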